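/- Let $n\ge 1$ and let $F:\mathbb{S}^n\to(0,\infty)$ be a smooth elliptic integrand, i.e. for every $x\in\mathbb{S}^n$ the symmetric map $A_F|_x[z]=D^2F|_x[z]+F(x)z$ is positive definite on $T_x\mathbb{S}^n$, where $D^2F$ is the intrinsic Hessian of $F$ on $\mathbb{S}^n$. Let $\mathcal{W}=\{F^*=1\}\subset\mathbb{R}^{n+1}$ be its Wulff shape, where $F^*(x)=\sup\{\langle x,\nu\rangle : \nu\in\mathbb{R}^{n+1},\ |\nu|F(\nu/|\nu|)\le 1\}$ (the constraint being satisfied by $\nu=0$), and let $\nu_{\mathcal{W}}$ be its outer unit normal. A hypersurface $\Sigma\subset\mathbb{R}^{n+1}$ is said to admit a radial parametrization with radius $u\in C^\infty(\mathcal{W})$ if $\psi(x)=x+u(x)\nu_{\mathcal{W}}(x)$ is a diffeomorphism of $\mathcal{W}$ onto $\Sigma$. Write $\|u\|_{C^1}=\sup_{\mathcal{W}}|u|+\sup_{\mathcal{W}}|\nabla u|$, with $\nabla$ the gradient of $\mathcal{W}$ for the metric induced from $\mathbb{R}^{n+1}$. There exist $\epsilon_0>0$ and $C_0>0$, depending only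 on $\mathcal{W}$, with the following property. If $\Sigma$ admits a radial parametrization with radius $u$ and $\|u\|_{C^1}\le\epsilon\le\epsilon_0$, then there exists $c=c(\Sigma)\in\mathbb{R}^{n+1}$ such that $\Sigma-c$ admits a radial parametrization $\psi_c:\mathcal{W}\to\Sigma-c$, $\psi_c(x)=x+u_c(x)\nu_{\mathcal{W}}(x)$, whose radius $u_c\in C^\infty(\mathcal{W})$ satisfies $$\|u_c\|_{C^1}\le C_0\,\epsilon\qquad\text{and}\qquad \int_{\mathcal{W}}u_c\,\langle w,\nu_{\mathcal{W}}\rangle\,d\mathcal{H}^n=0\quad\text{for every } w\in\mathbb{R}^{n+1}.$$ -/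

import Mathlib

open scoped Manifold ContDiff RealInnerProductSpace
open MeasureTheory

noncomputable section

namespace Wulff

/-- The ambient Euclidean space of dimension `n + 1`. -/
abbrev Amb (n : ℕ) : Type := EuclideanSpace ℝ (Fin (n + 1))

/-- The unit sphere of dimension `n`. -/
abbrev Sph (n : ℕ) : Type := Metric.sphere (0 : Amb n) 1

variable {n : ℕ}

open Classical in
/-- The extension `y ↦ F (y / |y|)` of `F`, homogeneous of degree zero (value `0` at the origin). -/
def homExt (F : Sph n → ℝ) (y : Amb n) : ℝ :=
  if h : ‖y‖⁻¹ • y ∈ Metric.sphere (0 : Amb n) 1 then F ⟨‖y‖⁻¹ • y, h⟩ else 0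

/-- The intrinsic Hessian of `F` on the sphere at `x`, as a bilinear form on tangent vectors
`z, w ⊥ x`. Great circles `γ` have `γ'' = -|γ'|² γ` and `homExt F` has no radial derivative, so the
Euclidean second derivative of `homExt F` restricted to `x^⊥` is the covariant Hessian. -/
def sphereHessian (F : Sph n → ℝ) (x : Sph n) (z w : Amb n) : ℝ :=
  fderiv ℝ (fderiv ℝ (homExt F)) (x : Amb n) z w

/-- The bilinear form of `A_F = D²F + F Id` at `x`, on tangent vectors `z, w ⊥ x`. -/
def formA (F : Sph n → ℝ) (x : Sph n) (z w : Amb n) : ℝ :=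
  sphereHessian F x z w + F x * ⟪z, w⟫

/-- Elliptic integrands: smooth positive functions on the sphere such that `A_F` is positive
definite on every tangent space. -/
structure IsEllipticIntegrand (F : Sph n → ℝ) : Prop where
  smooth : ContMDiff (𝓡 n) 𝓘(ℝ, ℝ) ∞ F
  pos : ∀ x, 0 < F x
  elliptic : ∀ (x : Sph n) (z : Amb n), ⟪(x : Amb n), z⟫ = 0 → z ≠ 0 → 0 < formA F x z z

/-- The gauge `F^*(x) = sup {⟨x, ν⟩ : |ν| F(ν / |ν|) ≤ 1}`. -/
def dualGauge (F : Sph n → ℝ) (x : Amb n) : ℝ :=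
  sSup {t : ℝ | ∃ ν : Amb n, ‖ν‖ * homExt F ν ≤ 1 ∧ t = ⟪x, ν⟫}

/-- The Wulff shape `{F^* = 1}`. -/
def shape (F : Sph n → ℝ) : Set (Amb n) := {x | dualGauge F x = 1}

/-- The outer unit normal of the Wulff shape, the boundary of `{F^* < 1}`. -/
def normal (F : Sph n → ℝ) (x : Amb n) : Amb n :=
  ‖gradient (dualGauge F) x‖⁻¹ • gradient (dualGauge F) x

/-- Smoothness of (the restriction to `S` of) a map, for an arbitrary subset `S` of Euclidean
space: locally it is the restriction of a smooth map defined on an open set. -/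
def SmoothOnSet {V : Type*} [NormedAddCommGroup V] [NormedSpace ℝ V]
    (f : Amb n → V) (S : Set (Amb n)) : Prop :=
  ∀ x ∈ S, ∃ (U : Set (Amb n)) (g : Amb n → V),
    IsOpen U ∧ x ∈ U ∧ ContDiffOn ℝ ∞ g U ∧ Set.EqOn f g (S ∩ U)

/-- `ψ` restricts to a diffeomorphism from `S` onto `T`, for subsets of Euclidean space. -/
def IsDiffeoOn (ψ : Amb n → Amb n) (S T : Set (Amb n)) : Prop :=
  SmoothOnSet ψ S ∧ Set.BijOn ψ S T ∧
    ∃ φ : Amb n → Amb n, SmoothOnSet φ T ∧ Set.InvOn φ ψ S T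

/-- `S` admits a radial parametrization over the Wulff shape `W` with radius `u`: the function `u`
is smooth on `W` and `x ↦ x + u(x) ν_W(x)` is a diffeomorphism of `W` onto `S`. Only the values of
`u` on `W` matter. -/
def IsRadialGraph (F : Sph n → ℝ) (S : Set (Amb n)) (u : Amb n → ℝ) : Prop :=
  SmoothOnSet u (shape F) ∧ IsDiffeoOn (fun x => x + u x • normal F x) (shape F) S

/-- The gradient of `u` on the Wulff shape with the induced metric: the tangential part of any
gradient of `u` along the Wulff shape (that part does not depend on the choice). -/
def tangentialGradient (F : Sph n → ℝ) (u : Amb n → ℝ) (x : Amb n) : Amb n :=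
  gradientWithin u (shape F) x - ⟪normal F x, gradientWithin u (shape F) x⟫ • normal F x

/-- The norm `‖u‖_{C^1} = sup |u| + sup |∇u|` on the Wulff shape. -/
def C1norm (F : Sph n → ℝ) (u : Amb n → ℝ) : ℝ :=
  (⨆ x : shape F, |u x|) + ⨆ x : shape F, ‖tangentialGradient F u x‖

/-- The function `φ_w = ⟨w, ν_W⟩`. -/
def phi (F : Sph n → ℝ) (w x : Amb n) : ℝ := ⟪w, normal F x⟫

/-- `L²`-orthogonality on the Wulff shape, with respect to the `n`-dimensional Hausdorff measure. -/
def L2Orthogonal (F : Sph n → ℝ) (f g : Amb n → ℝ) : Prop :=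
  IntegrableOn (fun x => f x * g x) (shape F) (Measure.hausdorffMeasure (n : ℝ)) ∧
    ∫ x in shape F, f x * g x ∂(Measure.hausdorffMeasure (n : ℝ)) = 0

end Wulff

end

/-! The gradient `X = wulffMap F` of the one-homogeneous function `h = support F` sends a unit
vector to the point of the Wulff shape with that outer normal. Ellipticity and compactness bound
`D²h` below by some `a > 0` on unit tangent vectors at unit points. Consider `Ψ(y) = X(y) + a y - a
y/|y|`. The negative contribution of `y/|y|` to its derivative is compensated by `D²h`, so `DΨ` is
coercive with constant `a` (`coercive_tubeMap`). Thus `Ψ` is strongly monotone off the origin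
(`tubeMap_monotone`), with a smooth, `1/a`-Lipschitz inverse. Since `Ψ(rξ) = X(ξ) + a(r-1)ξ` for
`|ξ| = 1`, it turns polar coordinates into normal coordinates, and yields a tube with a smooth foot
point map and a smooth signed distance.

In the tube the graph of `u` is the zero set of `G = signed distance - u(foot point)`, and `DG(z)`
differs from `⟨ξ, ·⟩` by `O(|z - X(ξ)| + ε)`. The radius `u_c` of the translate by `-c` is, over the
normal `ξ`, the root `t` of `G(X(ξ) + tξ + c) = 0`. The root exists by the intermediate value
theorem, is unique by the derivative bound, is smooth by the implicit function theorem
(`contDiffAt_shiftedRadius`), and has `C¹` size `O(ε + |c|)`.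

To first order `u_c - u_d = -⟨ξ, c - d⟩` (`root_sub_le`). Hence `Φ(c) = -∫ u_c ν` is a small
Lipschitz perturbation of the linear map `M = ∫ ν ⊗ ν`, which is positive definite because a set of
positive area has its normals in any given open half-space (`inner_normalMoment_pos`). As `Φ(0) =
O(ε)`, quantitative surjectivity gives a zero `c` of `Φ` with `|c| = O(ε)`
(`exists_radiusMoment_eq_zero`), and this is the required translation. -/

noncomputable section

namespace Wulff

variable {n : ℕ} {F : Sph n → ℝ} {a r K ε ρ : ℝ} {u : Amb n → ℝ}

/-! ### The one-homogeneous extension and its gradient -/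

/-- The one-homogeneous extension `y ↦ |y| F (y / |y|)` of `F`. -/
def support (F : Sph n → ℝ) (y : Amb n) : ℝ := ‖y‖ * homExt F y

/-- The parametrization of the Wulff shape by its outer normal: the gradient of `support F`. -/
def wulffMap (F : Sph n → ℝ) (y : Amb n) : Amb n := gradient (support F) y

theorem homExt_coe (F : Sph n → ℝ) (ξ : Sph n) : homExt F (ξ : Amb n) = F ξ := by
  have h : ‖(ξ : Amb n)‖⁻¹ • (ξ : Amb n) = ξ := by simp
  have h' : ‖(ξ : Amb n)‖⁻¹ • (ξ : Amb n) ∈ Metric.sphere (0 : Amb n) 1 := by rw [h]; exact ξ.2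
  rw [homExt, dif_pos h']
  congr 1
  exact Subtype.ext h

theorem homExt_smul (F : Sph n → ℝ) {r : ℝ} (hr : 0 < r) (y : Amb n) :
    homExt F (r • y) = homExt F y := by
  have h : ‖r • y‖⁻¹ • r • y = ‖y‖⁻¹ • y := by
    rw [norm_smul, Real.norm_of_nonneg hr.le, smul_smul, mul_inv]
    congr 1
    field_simp
  unfold homExt
  congr! 2
  simp only [h]

theorem inv_norm_smul_mem_sphere {y : Amb n} (hy : y ≠ 0) :
    ‖y‖⁻¹ • y ∈ Metric.sphere (0 : Amb n) 1 := by
  simp [norm_smul, hy]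

theorem homExt_of_ne_zero (F : Sph n → ℝ) {y : Amb n} (hy : y ≠ 0) :
    homExt F y = F ⟨‖y‖⁻¹ • y, inv_norm_smul_mem_sphere hy⟩ := by
  rw [homExt, dif_pos (inv_norm_smul_mem_sphere hy)]

/-- Intrinsic smoothness becomes Euclidean smoothness by composing with the normalization, a smooth
map from the punctured space to the sphere. -/
theorem contDiffAt_homExt (hF : ContMDiff (𝓡 n) 𝓘(ℝ, ℝ) ∞ F) {y : Amb n} (hy : y ≠ 0) :
    ContDiffAt ℝ ∞ (homExt F) y := by
  let U : TopologicalSpace.Opens (Amb n) := ⟨{0}ᶜ, isOpen_compl_singleton⟩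
  have h1 : ContMDiff 𝓘(ℝ, Amb n) 𝓘(ℝ, Amb n) ∞ (fun z : U => ‖(z : Amb n)‖⁻¹ • (z : Amb n)) := by
    intro z
    have : ContMDiffAt 𝓘(ℝ, Amb n) 𝓘(ℝ, Amb n) ∞ (fun z : Amb n => ‖z‖⁻¹ • z) (z : Amb n) := by
      apply ContDiffAt.contMDiffAt
      have hz : (z : Amb n) ≠ 0 := z.2
      exact ((contDiffAt_norm ℝ hz).inv (norm_ne_zero_iff.2 hz)).smul contDiffAt_id
    exact contMDiffAt_subtype_iff.2 this
  have : Fact (Module.finrank ℝ (Amb n) = n + 1) := ⟨finrank_euclideanSpace_fin⟩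
  have h2 := ContMDiff.codRestrict_sphere (n := n) h1 (fun z => inv_norm_smul_mem_sphere z.2)
  have h3 := hF.comp h2
  have h4 : ContMDiffAt 𝓘(ℝ, Amb n) 𝓘(ℝ, ℝ) ∞ (homExt F) y := by
    have := h3 (⟨y, hy⟩ : U)
    refine (contMDiffAt_subtype_iff (U := U) (x := ⟨y, hy⟩) (f := homExt F)).1 ?_
    convert this using 1
    ext z
    exact homExt_of_ne_zero F z.2
  exact contMDiffAt_iff_contDiffAt.1 h4

theorem contDiffAt_support (hF : IsEllipticIntegrand F) {y : Amb n} (hy : y ≠ 0) :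
    ContDiffAt ℝ ∞ (support F) y :=
  (contDiffAt_norm ℝ hy).mul (contDiffAt_homExt hF.smooth hy)

theorem contDiffAt_wulffMap (hF : IsEllipticIntegrand F) {y : Amb n} (hy : y ≠ 0) :
    ContDiffAt ℝ ∞ (wulffMap F) y :=
  ((InnerProductSpace.toDual ℝ (Amb n)).symm.toContinuousLinearEquiv.contDiff.contDiffAt).comp y
    ((contDiffAt_support hF hy).fderiv_right (m := ∞) (by simp))

theorem hasGradientAt_support (hF : IsEllipticIntegrand F) {y : Amb n} (hy : y ≠ 0) :
    HasGradientAt (support F) (wulffMap F y) y :=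
  ((contDiffAt_support hF hy).differentiableAt (by simp)).hasGradientAt

theorem hasFDerivAt_wulffMap (hF : IsEllipticIntegrand F) {y : Amb n} (hy : y ≠ 0) :
    HasFDerivAt (wulffMap F) (fderiv ℝ (wulffMap F) y) y :=
  ((contDiffAt_wulffMap hF hy).differentiableAt (by simp)).hasFDerivAt

theorem support_smul (F : Sph n → ℝ) {r : ℝ} (hr : 0 < r) (y : Amb n) :
    support F (r • y) = r * support F y := by
  rw [support, support, homExt_smul F hr, norm_smul, Real.norm_of_nonneg hr.le, mul_assoc]

theorem support_coe (F : Sph n → ℝ) (ξ : Sph n) : support F (ξ : Amb n) = F ξ := by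
  rw [support, homExt_coe]; simp

theorem support_pos (hF : IsEllipticIntegrand F) {y : Amb n} (hy : y ≠ 0) : 0 < support F y := by
  rw [support, homExt_of_ne_zero F hy]
  exact mul_pos (norm_pos_iff.2 hy) (hF.pos _)

/-- The Euler identity for the one-homogeneous function `support F`. -/
theorem inner_wulffMap_self (hF : IsEllipticIntegrand F) {y : Amb n} (hy : y ≠ 0) :
    ⟪wulffMap F y, y⟫ = support F y := by
  have h1 : HasDerivAt (fun t : ℝ => support F (t • y)) (⟪wulffMap F y, y⟫) 1 := by
    have hd : HasDerivAt (fun t : ℝ => t • y) y 1 := by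
      simpa using (hasDerivAt_id (1 : ℝ)).smul_const y
    have hg := (hasGradientAt_support hF hy).hasFDerivAt
    rw [← one_smul ℝ y] at hg
    have := hg.comp_hasDerivAt (1 : ℝ) hd
    rwa [one_smul] at this
  have h2 : HasDerivAt (fun t : ℝ => support F (t • y)) (support F y) 1 := by
    have : HasDerivAt (fun t : ℝ => t * support F y) (support F y) 1 := by
      simpa using (hasDerivAt_id (1 : ℝ)).mul_const (support F y)
    refine this.congr_of_eventuallyEq ?_
    filter_upwards [lt_mem_nhds (zero_lt_one' ℝ)] with t ht
    exact support_smul F ht y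
  exact h1.unique h2

/-- The identity `h(rz) = r h(z)` is differentiated in `z` on both sides. -/
theorem wulffMap_smul (hF : IsEllipticIntegrand F) {r : ℝ} (hr : 0 < r) {y : Amb n} (hy : y ≠ 0) :
    wulffMap F (r • y) = wulffMap F y := by
  have hry : r • y ≠ 0 := smul_ne_zero hr.ne' hy
  have h1 : HasFDerivAt (fun z : Amb n => support F (r • z))
      (r • InnerProductSpace.toDual ℝ _ (wulffMap F (r • y))) y := by
    have := (hasGradientAt_support hF hry).hasFDerivAt.comp y
      ((hasFDerivAt_id (𝕜 := ℝ) y).const_smul r)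
    refine this.congr_fderiv ?_
    ext v
    simp
  have h2 : HasFDerivAt (fun z : Amb n => support F (r • z))
      (r • InnerProductSpace.toDual ℝ _ (wulffMap F y)) y := by
    have := (hasGradientAt_support hF hy).hasFDerivAt.const_mul r
    simpa only [← support_smul F hr] using this
  have h3 := h1.unique h2
  rw [← map_smul, ← map_smul] at h3
  exact smul_right_injective _ hr.ne' ((InnerProductSpace.toDual ℝ (Amb n)).injective h3)

/-- Differentiating the Euler identity, the terms `⟨X(y), v⟩` cancel. Geometrically, `y` is normal
to the Wulff shape at `X(y)`. -/
theorem inner_fderiv_wulffMap (hF : IsEllipticIntegrand F) {y : Amb n} (hy : y ≠ 0) (v : Amb n) :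
    ⟪fderiv ℝ (wulffMap F) y v, y⟫ = 0 := by
  have h1 := (hasFDerivAt_wulffMap hF hy).inner ℝ (hasFDerivAt_id y)
  have h2 : HasFDerivAt (fun z => ⟪wulffMap F z, id z⟫)
      (InnerProductSpace.toDual ℝ _ (wulffMap F y)) y := by
    refine (hasGradientAt_support hF hy).hasFDerivAt.congr_of_eventuallyEq ?_
    filter_upwards [isOpen_ne.mem_nhds hy] with z hz
    exact inner_wulffMap_self hF hz
  have h3 := congrArg (fun L => L v) (h1.unique h2)
  simpa [fderivInnerCLM_apply] using h3

theorem fderiv_wulffMap_self (hF : IsEllipticIntegrand F) {y : Amb n} (hy : y ≠ 0) :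
    fderiv ℝ (wulffMap F) y y = 0 := by
  have h1 : HasDerivAt (fun t : ℝ => wulffMap F (t • y)) (fderiv ℝ (wulffMap F) y y) 1 := by
    have hd : HasDerivAt (fun t : ℝ => t • y) y 1 := by
      simpa using (hasDerivAt_id (1 : ℝ)).smul_const y
    have hg := hasFDerivAt_wulffMap hF hy
    rw [← one_smul ℝ y] at hg
    have := hg.comp_hasDerivAt (1 : ℝ) hd
    rwa [one_smul] at this
  have h2 : HasDerivAt (fun t : ℝ => wulffMap F (t • y)) 0 1 := by
    refine (hasDerivAt_const (1 : ℝ) (wulffMap F y)).congr_of_eventuallyEq ?_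
    filter_upwards [lt_mem_nhds (zero_lt_one' ℝ)] with t ht
    exact wulffMap_smul hF ht hy
  exact h1.unique h2

theorem fderiv_wulffMap_smul (hF : IsEllipticIntegrand F) {r : ℝ} (hr : 0 < r) {y : Amb n}
    (hy : y ≠ 0) : fderiv ℝ (wulffMap F) (r • y) = r⁻¹ • fderiv ℝ (wulffMap F) y := by
  have hry : r • y ≠ 0 := smul_ne_zero hr.ne' hy
  have h1 : HasFDerivAt (fun z : Amb n => wulffMap F (r • z))
      (r • fderiv ℝ (wulffMap F) (r • y)) y := by
    have := (hasFDerivAt_wulffMap hF hry).comp y ((hasFDerivAt_id (𝕜 := ℝ) y).const_smul r)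
    refine this.congr_fderiv ?_
    ext v
    simp
  have h2 : HasFDerivAt (fun z : Amb n => wulffMap F (r • z)) (fderiv ℝ (wulffMap F) y) y := by
    refine (hasFDerivAt_wulffMap hF hy).congr_of_eventuallyEq ?_
    filter_upwards [isOpen_ne.mem_nhds hy] with z hz
    exact wulffMap_smul hF hr hz
  rw [← h1.unique h2, smul_smul, inv_mul_cancel₀ hr.ne', one_smul]

theorem hasGradientAt_norm {y : Amb n} (hy : y ≠ 0) :
    HasGradientAt (fun z : Amb n => ‖z‖) (‖y‖⁻¹ • y) y := by
  have h : HasFDerivAt (fun z : Amb n => Real.sqrt (‖z‖ ^ 2)) _ y :=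
    (hasStrictFDerivAt_norm_sq y).hasFDerivAt.sqrt (by simpa using hy)
  rw [hasGradientAt_iff_hasFDerivAt]
  refine (h.congr_of_eventuallyEq (Filter.Eventually.of_forall fun z => ?_)).congr_fderiv ?_
  · simp
  · ext v
    simp
    ring

theorem wulffMap_eq (hF : IsEllipticIntegrand F) {y : Amb n} (hy : y ≠ 0) (v : Amb n) :
    ⟪wulffMap F y, v⟫ = ‖y‖ * fderiv ℝ (homExt F) y v + homExt F y * (‖y‖⁻¹ * ⟪y, v⟫) := by
  have h1 := (hasGradientAt_norm hy).hasFDerivAt.mul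
    ((contDiffAt_homExt hF.smooth hy).differentiableAt (by simp)).hasFDerivAt
  have h2 := congrArg (fun L => L v) ((hasGradientAt_support hF hy).hasFDerivAt.unique h1)
  simpa [real_inner_smul_left] using h2

/-- This is where ellipticity enters: the Hessian of `h` is `A_F` on tangent vectors. In the formula
of `wulffMap_eq` the derivatives of `|y|` and `|y|⁻¹` along `z` vanish at `ξ` because `z ⊥ ξ`. -/
theorem inner_fderiv_wulffMap_eq_formA (hF : IsEllipticIntegrand F) (ξ : Sph n) (z : Amb n)
    (hz : ⟪(ξ : Amb n), z⟫ = 0) : ⟪fderiv ℝ (wulffMap F) ξ z, z⟫ = formA F ξ z z := by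
  have hξ : (ξ : Amb n) ≠ 0 := ne_zero_of_mem_unit_sphere ξ
  have hn : ‖(ξ : Amb n)‖ = 1 := by simp
  have h1 : HasFDerivAt (fun y => ⟪wulffMap F y, z⟫)
      ((innerSL ℝ z).comp (fderiv ℝ (wulffMap F) ξ)) (ξ : Amb n) := by
    have := (innerSL ℝ z).hasFDerivAt.comp (ξ : Amb n) (hasFDerivAt_wulffMap hF hξ)
    refine this.congr_of_eventuallyEq (Filter.Eventually.of_forall fun y => ?_)
    simp [real_inner_comm]
  have hnorm := (hasGradientAt_norm hξ).hasFDerivAt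
  have hsm := contDiffAt_homExt hF.smooth hξ
  have hf := (hsm.differentiableAt (by simp)).hasFDerivAt
  have hf' : HasFDerivAt (fun y => fderiv ℝ (homExt F) y z)
      ((ContinuousLinearMap.apply ℝ ℝ z).comp (fderiv ℝ (fderiv ℝ (homExt F)) (ξ : Amb n))) ξ :=
    (ContinuousLinearMap.apply ℝ ℝ z).hasFDerivAt.comp (ξ : Amb n)
      ((hsm.fderiv_right (m := ∞) (by simp)).differentiableAt (by simp)).hasFDerivAt
  have hinv := ((hasDerivAt_inv (by simp : ‖(ξ : Amb n)‖ ≠ 0)).comp_hasFDerivAt (ξ : Amb n) hnorm)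
  have hin : HasFDerivAt (fun y : Amb n => ⟪y, z⟫) (innerSL ℝ z) (ξ : Amb n) := by
    refine (innerSL ℝ z).hasFDerivAt.congr_of_eventuallyEq (Filter.Eventually.of_forall fun y => ?_)
    simp [real_inner_comm]
  have h2 := (hnorm.mul hf').add (hf.mul (hinv.mul hin))
  have h3 := h2.congr_of_eventuallyEq (f₁ := fun y => ⟪wulffMap F y, z⟫) (by
    filter_upwards [isOpen_ne.mem_nhds hξ] with y hy
    exact wulffMap_eq hF hy z)
  have h4 := congrArg (fun L => L z) (h1.unique h3)
  simp [hn, hz, homExt_coe] at h4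
  rw [formA, sphereHessian, real_inner_comm, h4]
  simp

/-! ### Uniform convexity -/

/-- A constant that bounds both the integrand and the form `A_F` from below. -/
structure IsConvexityConst (F : Sph n → ℝ) (a : ℝ) : Prop where
  pos : 0 < a
  le_apply : ∀ ξ, a ≤ F ξ
  coercive : ∀ (ξ : Sph n) (z : Amb n), ⟪(ξ : Amb n), z⟫ = 0 →
    a * ‖z‖ ^ 2 ≤ ⟪fderiv ℝ (wulffMap F) ξ z, z⟫

theorem continuousOn_fderiv_wulffMap (hF : IsEllipticIntegrand F) :
    ContinuousOn (fderiv ℝ (wulffMap F)) {0}ᶜ := fun _ hy =>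
  ((contDiffAt_wulffMap hF hy).fderiv_right (m := ∞) (by simp)).continuousAt.continuousWithinAt

theorem exists_isConvexityConst (hF : IsEllipticIntegrand F) : ∃ a, IsConvexityConst F a := by
  have : Nonempty (Sph n) := (NormedSpace.sphere_nonempty.2 zero_le_one).to_subtype
  obtain ⟨b, hb, hbF⟩ : ∃ b, 0 < b ∧ ∀ ξ, b ≤ F ξ := by
    obtain ⟨ξ, -, hξ⟩ := isCompact_univ.exists_isMinOn (Set.univ_nonempty (α := Sph n))
      hF.smooth.continuous.continuousOn
    exact ⟨F ξ, hF.pos ξ, fun η => hξ (Set.mem_univ η)⟩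
  -- The unit tangent bundle of the sphere, which is compact; it is empty for `n = 0`, where any
  -- constant serves.
  let K : Set (Amb n × Amb n) :=
    (Metric.sphere 0 1 ×ˢ Metric.sphere 0 1) ∩ {p | ⟪p.1, p.2⟫ = 0}
  have hK : IsCompact K := ((isCompact_sphere _ _).prod (isCompact_sphere _ _)).inter_right
    (isClosed_eq (continuous_fst.inner continuous_snd) continuous_const)
  have hcont : ContinuousOn (fun p : Amb n × Amb n => ⟪fderiv ℝ (wulffMap F) p.1 p.2, p.2⟫) K := by
    refine ContinuousOn.inner ?_ continuousOn_snd
    refine ContinuousOn.clm_apply ?_ continuousOn_snd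
    refine (continuousOn_fderiv_wulffMap hF).comp continuousOn_fst fun p hp => ?_
    exact ne_zero_of_mem_unit_sphere (⟨p.1, hp.1.1⟩ : Sph n)
  obtain ⟨l, hl, hlK⟩ : ∃ l, 0 < l ∧ ∀ p ∈ K, l ≤ ⟪fderiv ℝ (wulffMap F) p.1 p.2, p.2⟫ := by
    rcases K.eq_empty_or_nonempty with h | h
    · exact ⟨1, one_pos, by simp [h]⟩
    obtain ⟨p, hp, hmin⟩ := hK.exists_isMinOn h hcont
    refine ⟨_, ?_, fun q hq => hmin hq⟩
    refine lt_of_lt_of_eq ?_ (inner_fderiv_wulffMap_eq_formA hF ⟨p.1, hp.1.1⟩ p.2 hp.2).symm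
    exact hF.elliptic _ _ hp.2 (ne_zero_of_mem_unit_sphere (⟨p.2, hp.1.2⟩ : Sph n))
  refine ⟨min b l, lt_min hb hl, fun ξ => (min_le_left _ _).trans (hbF ξ), fun ξ z hz => ?_⟩
  rcases eq_or_ne z 0 with rfl | hz0
  · simp
  have h := hlK (ξ, ‖z‖⁻¹ • z) ⟨⟨ξ.2, inv_norm_smul_mem_sphere hz0⟩, by
    simp [real_inner_smul_right, hz]⟩
  have hzp : 0 < ‖z‖ := norm_pos_iff.2 hz0
  simp only [map_smul, real_inner_smul_left, real_inner_smul_right] at h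
  have h' : l * ‖z‖ ^ 2 ≤ ⟪fderiv ℝ (wulffMap F) ξ z, z⟫ := by
    calc l * ‖z‖ ^ 2 ≤ (‖z‖⁻¹ * (‖z‖⁻¹ * ⟪fderiv ℝ (wulffMap F) ξ z, z⟫)) * ‖z‖ ^ 2 := by gcongr
      _ = _ := by field_simp
  exact le_trans (by gcongr; exact min_le_right _ _) h'

/-! ### Normal coordinates and their strong monotonicity -/

/-- Normal coordinates around the Wulff shape: the point `r • ξ` with `|ξ| = 1` is mapped to the
point at signed distance `a * (r - 1)` from the Wulff shape in the normal direction `ξ`. -/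
def tubeMap (F : Sph n → ℝ) (a : ℝ) (y : Amb n) : Amb n :=
  wulffMap F y + a • y - a • ‖y‖⁻¹ • y

theorem contDiffAt_normalize {y : Amb n} (hy : y ≠ 0) :
    ContDiffAt ℝ ∞ (fun z : Amb n => ‖z‖⁻¹ • z) y :=
  ((contDiffAt_norm ℝ hy).inv (norm_ne_zero_iff.2 hy)).smul contDiffAt_id

theorem contDiffAt_tubeMap (hF : IsEllipticIntegrand F) (a : ℝ) {y : Amb n} (hy : y ≠ 0) :
    ContDiffAt ℝ ∞ (tubeMap F a) y := by
  have h1 : ContDiffAt ℝ ∞ (fun z : Amb n => a • z) y := contDiffAt_id.const_smul a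
  have h2 : ContDiffAt ℝ ∞ (fun z : Amb n => a • ‖z‖⁻¹ • z) y :=
    (contDiffAt_normalize hy).const_smul a
  exact ((contDiffAt_wulffMap hF hy).add h1).sub h2

theorem hasFDerivAt_normalize {y : Amb n} (hy : y ≠ 0) :
    HasFDerivAt (fun z : Amb n => ‖z‖⁻¹ • z)
      (‖y‖⁻¹ • ContinuousLinearMap.id ℝ (Amb n) -
        (‖y‖⁻¹ ^ 3) • (innerSL ℝ y).smulRight y) y := by
  have hn : ‖y‖ ≠ 0 := norm_ne_zero_iff.2 hy
  have hinv := (hasDerivAt_inv hn).comp_hasFDerivAt y (hasGradientAt_norm hy).hasFDerivAt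
  refine (hinv.smul (hasFDerivAt_id y)).congr_fderiv ?_
  ext1 v
  simp [sub_eq_add_neg, smul_smul]
  congr 1
  ring

theorem hasFDerivAt_tubeMap (hF : IsEllipticIntegrand F) (a : ℝ) {y : Amb n} (hy : y ≠ 0) :
    HasFDerivAt (tubeMap F a) (fderiv ℝ (tubeMap F a) y) y :=
  ((contDiffAt_tubeMap hF a hy).differentiableAt (by simp)).hasFDerivAt

theorem fderiv_tubeMap_apply (hF : IsEllipticIntegrand F) (a : ℝ) {y : Amb n} (hy : y ≠ 0)
    (v : Amb n) : fderiv ℝ (tubeMap F a) y v = fderiv ℝ (wulffMap F) y v + a • v -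
      a • (‖y‖⁻¹ • v - (‖y‖⁻¹ ^ 3 * ⟪y, v⟫) • y) := by
  have h := ((hasFDerivAt_wulffMap hF hy).add ((hasFDerivAt_id (𝕜 := ℝ) y).const_smul a)).sub
    ((hasFDerivAt_normalize hy).const_smul a)
  have h' := (hasFDerivAt_tubeMap hF a hy).unique h
  rw [h']
  simp [smul_smul]

/-- The derivatives of `X` and of the normalization both take values orthogonal to `y`, so only the
term `a • v` contributes. Hence the signed distance has the normal as gradient. -/
theorem inner_fderiv_tubeMap (hF : IsEllipticIntegrand F) (a : ℝ) {y : Amb n} (hy : y ≠ 0)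
    (v : Amb n) : ⟪fderiv ℝ (tubeMap F a) y v, y⟫ = a * ⟪v, y⟫ := by
  have hn : ‖y‖ ≠ 0 := norm_ne_zero_iff.2 hy
  rw [fderiv_tubeMap_apply hF a hy]
  simp only [inner_sub_left, inner_add_left, real_inner_smul_left, inner_fderiv_wulffMap hF hy,
    real_inner_self_eq_norm_sq, real_inner_comm v y]
  field_simp
  ring

/-- The derivative of `X` is homogeneous of degree `-1`, kills the radial direction and maps into
the orthogonal complement of `y`. Only the tangential part of `v` counts, and the bound on the
sphere applies to it. -/
theorem coercive_wulffMap (hF : IsEllipticIntegrand F) (ha : IsConvexityConst F a) {y : Amb n}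
    (hy : y ≠ 0) (v : Amb n) :
    a * (‖y‖⁻¹ * ‖v‖ ^ 2 - ‖y‖⁻¹ ^ 3 * ⟪y, v⟫ ^ 2) ≤ ⟪fderiv ℝ (wulffMap F) y v, v⟫ := by
  have hn : 0 < ‖y‖ := norm_pos_iff.2 hy
  let ξ : Sph n := ⟨‖y‖⁻¹ • y, inv_norm_smul_mem_sphere hy⟩
  have hξ : (ξ : Amb n) ≠ 0 := ne_zero_of_mem_unit_sphere ξ
  have hξ1 : ‖(ξ : Amb n)‖ = 1 := by simp
  have hyξ : y = ‖y‖ • (ξ : Amb n) := by simp [ξ, smul_smul, hn.ne']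
  set α := ⟪(ξ : Amb n), v⟫ with hα
  have hself : ⟪(ξ : Amb n), ξ⟫ = 1 := by simp
  have hc := ha.coercive ξ (v - α • (ξ : Amb n)) (by
    rw [inner_sub_right, real_inner_smul_right, hself]; simp [hα])
  have h1 : ⟪fderiv ℝ (wulffMap F) ξ (v - α • (ξ : Amb n)), v - α • (ξ : Amb n)⟫ =
      ⟪fderiv ℝ (wulffMap F) ξ v, v⟫ := by
    rw [map_sub, map_smul, fderiv_wulffMap_self hF hξ, inner_sub_right, real_inner_smul_right]
    simp [inner_fderiv_wulffMap hF hξ]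
  have h2 : ‖v - α • (ξ : Amb n)‖ ^ 2 = ‖v‖ ^ 2 - α ^ 2 := by
    rw [norm_sub_sq_real, real_inner_smul_right, norm_smul, real_inner_comm, ← hα, hξ1]
    simp
    ring
  have h3 : ⟪fderiv ℝ (wulffMap F) y v, v⟫ = ‖y‖⁻¹ * ⟪fderiv ℝ (wulffMap F) ξ v, v⟫ := by
    conv_lhs => rw [hyξ, fderiv_wulffMap_smul hF hn hξ]
    simp [real_inner_smul_left]
  have h4 : ⟪y, v⟫ = ‖y‖ * α := by
    conv_lhs => rw [hyξ]
    rw [real_inner_smul_left]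
  rw [h1, h2] at hc
  rw [h3, h4]
  calc a * (‖y‖⁻¹ * ‖v‖ ^ 2 - ‖y‖⁻¹ ^ 3 * (‖y‖ * α) ^ 2)
      = ‖y‖⁻¹ * (a * (‖v‖ ^ 2 - α ^ 2)) := by field_simp
    _ ≤ _ := by gcongr

/-- The lower bound for `D²h` equals the quadratic form of the derivative of `a y/|y|`, so the two
cancel and `a|v|²` remains. The coefficient `a` in the definition of `tubeMap` is chosen for this.
-/
theorem coercive_tubeMap (hF : IsEllipticIntegrand F) (ha : IsConvexityConst F a) {y : Amb n}
    (hy : y ≠ 0) (v : Amb n) : a * ‖v‖ ^ 2 ≤ ⟪fderiv ℝ (tubeMap F a) y v, v⟫ := by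
  have h := coercive_wulffMap hF ha hy v
  rw [fderiv_tubeMap_apply hF a hy]
  simp only [inner_sub_left, inner_add_left, real_inner_smul_left, real_inner_self_eq_norm_sq]
  nlinarith

theorem tubeMap_smul (hF : IsEllipticIntegrand F) (a : ℝ) {r : ℝ} (hr : 0 < r) {ξ : Amb n}
    (hξ : ‖ξ‖ = 1) : tubeMap F a (r • ξ) = wulffMap F ξ + (a * (r - 1)) • ξ := by
  have hξ0 : ξ ≠ 0 := norm_ne_zero_iff.1 (by rw [hξ]; exact one_ne_zero)
  rw [tubeMap, wulffMap_smul hF hr hξ0, norm_smul, hξ, Real.norm_of_nonneg hr.le, mul_one,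
    smul_smul r⁻¹, inv_mul_cancel₀ hr.ne', one_smul, mul_sub, sub_smul, smul_smul, mul_one]
  abel

theorem tubeMap_of_norm_eq_one (hF : IsEllipticIntegrand F) (a : ℝ) {ξ : Amb n} (hξ : ‖ξ‖ = 1) :
    tubeMap F a ξ = wulffMap F ξ := by
  simpa using tubeMap_smul hF a one_pos hξ

theorem le_support (ha : IsConvexityConst F a) (y : Amb n) : a * ‖y‖ ≤ support F y := by
  rcases eq_or_ne y 0 with rfl | hy
  · simp [support]
  rw [support, homExt_of_ne_zero F hy, mul_comm]
  gcongr
  exact ha.le_apply _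

/-- Strong monotonicity of the normal coordinate map. -/
theorem tubeMap_monotone (hF : IsEllipticIntegrand F) (ha : IsConvexityConst F a) {y z : Amb n}
    (hy : y ≠ 0) (hz : z ≠ 0) :
    a * ‖y - z‖ ^ 2 ≤ ⟪tubeMap F a y - tubeMap F a z, y - z⟫ := by
  -- `tubeMap` is singular at the origin. If the segment from `z` to `y` meets it, the points lie on
  -- opposite rays, and the Euler identity with `h ≥ a|·|` gives the bound. Otherwise the mean value
  -- inequality along the segment applies.
  by_cases hseg : ∃ t ∈ Set.Icc (0 : ℝ) 1, z + t • (y - z) = 0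
  · obtain ⟨t, ⟨ht0, ht1⟩, ht⟩ := hseg
    have ht1' : 0 < 1 - t := by
      rcases ht1.lt_or_eq with h | rfl
      · linarith
      · simp [hy] at ht
    have ht0' : 0 < t := by
      rcases ht0.lt_or_eq with h | rfl
      · exact h
      · simp [hz] at ht
    obtain ⟨k, hk, rfl⟩ : ∃ k : ℝ, 0 < k ∧ z = k • (-y) := by
      refine ⟨t / (1 - t), by positivity, ?_⟩
      have : (1 - t) • z = t • (-y) := by
        rw [← sub_eq_zero, ← ht]
        module
      rw [div_eq_inv_mul, mul_smul, ← this, smul_smul, inv_mul_cancel₀ ht1'.ne', one_smul]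
    have hny : -y ≠ 0 := neg_ne_zero.2 hy
    have hyp : 0 < ‖y‖ := norm_pos_iff.2 hy
    have h1 : tubeMap F a y - tubeMap F a (k • (-y)) =
        wulffMap F y - wulffMap F (-y) + (a * (1 + k) - 2 * a * ‖y‖⁻¹) • y := by
      rw [tubeMap, tubeMap, wulffMap_smul hF hk hny, norm_smul, norm_neg,
        Real.norm_of_nonneg hk.le, smul_smul (k * ‖y‖)⁻¹]
      have : (k * ‖y‖)⁻¹ * k = ‖y‖⁻¹ := by field_simp
      rw [this]
      module
    have h2 : y - k • (-y) = (1 + k) • y := by module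
    have h3 := inner_wulffMap_self hF hy
    have h4 := inner_wulffMap_self hF hny
    rw [inner_neg_right] at h4
    rw [h1, h2, norm_smul, real_inner_smul_right, inner_add_left, inner_sub_left,
      real_inner_smul_left, real_inner_self_eq_norm_sq, h3, Real.norm_of_nonneg (by positivity)]
    have h5 := le_support ha y
    have h6 := le_support ha (-y)
    rw [norm_neg] at h6
    have h7 : 2 * a * ‖y‖⁻¹ * ‖y‖ ^ 2 = 2 * a * ‖y‖ := by field_simp
    have h8 : ⟪wulffMap F (-y), y⟫ = - support F (-y) := by linarith
    rw [h8]
    nlinarith [mul_nonneg (by positivity : (0:ℝ) ≤ 1 + k)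
      (by linarith : 0 ≤ support F y + support F (-y) - 2 * a * ‖y‖)]
  · push Not at hseg
    have hd : ∀ t ∈ Set.Icc (0 : ℝ) 1,
        HasDerivAt (fun t : ℝ => ⟪tubeMap F a (z + t • (y - z)), y - z⟫)
          ⟪fderiv ℝ (tubeMap F a) (z + t • (y - z)) (y - z), y - z⟫ t := by
      intro t ht
      have h1 : HasDerivAt (fun t : ℝ => z + t • (y - z)) (y - z) t := by
        simpa using ((hasDerivAt_id t).smul_const (y - z)).const_add z
      have h2 := (hasFDerivAt_tubeMap hF a (hseg t ht)).comp_hasDerivAt t h1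
      have h3 := h2.inner ℝ (hasDerivAt_const t (y - z))
      simpa using h3
    have hmv := (convex_Icc (0 : ℝ) 1).mul_sub_le_image_sub_of_le_deriv
      (f := fun t : ℝ => ⟪tubeMap F a (z + t • (y - z)), y - z⟫) (C := a * ‖y - z‖ ^ 2)
      (fun t ht => (hd t ht).continuousAt.continuousWithinAt)
      (fun t ht => (hd t (interior_subset ht)).differentiableAt.differentiableWithinAt)
      (fun t ht => by
        rw [(hd t (interior_subset ht)).deriv]
        exact coercive_tubeMap hF ha (hseg t (interior_subset ht)) _)
      0 (by simp) 1 (by simp) zero_le_one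
    simpa [inner_sub_left] using hmv

theorem tubeMap_antilipschitz (hF : IsEllipticIntegrand F) (ha : IsConvexityConst F a)
    {y z : Amb n} (hy : y ≠ 0) (hz : z ≠ 0) :
    a * ‖y - z‖ ≤ ‖tubeMap F a y - tubeMap F a z‖ := by
  rcases eq_or_ne y z with rfl | hne
  · simp
  have hp : 0 < ‖y - z‖ := norm_pos_iff.2 (sub_ne_zero.2 hne)
  have h1 := tubeMap_monotone hF ha hy hz
  have h2 := real_inner_le_norm (tubeMap F a y - tubeMap F a z) (y - z)
  refine le_of_mul_le_mul_right ?_ hp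
  nlinarith

/-! ### The Wulff shape as image of the gradient map, and its normal -/

/-- In the monotonicity of `tubeMap` the quadratic terms cancel, leaving `a` times the pairing for
`y/|y|`, which is nonnegative by Cauchy–Schwarz. -/
theorem wulffMap_monotone (hF : IsEllipticIntegrand F) {y z : Amb n} (hy : y ≠ 0) (hz : z ≠ 0) :
    0 ≤ ⟪wulffMap F y - wulffMap F z, y - z⟫ := by
  obtain ⟨a, ha⟩ := exists_isConvexityConst hF
  have h := tubeMap_monotone hF ha hy hz
  have hyp : 0 < ‖y‖ := norm_pos_iff.2 hy
  have hzp : 0 < ‖z‖ := norm_pos_iff.2 hz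
  have e : tubeMap F a y - tubeMap F a z =
      (wulffMap F y - wulffMap F z) + a • (y - z) - a • (‖y‖⁻¹ • y - ‖z‖⁻¹ • z) := by
    simp only [tubeMap]; module
  rw [e, inner_sub_left, inner_add_left, real_inner_smul_left, real_inner_self_eq_norm_sq,
    real_inner_smul_left] at h
  have h2 : 0 ≤ ⟪‖y‖⁻¹ • y - ‖z‖⁻¹ • z, y - z⟫ := by
    simp only [inner_sub_left, inner_sub_right, real_inner_smul_left, real_inner_self_eq_norm_sq]
    have h3 := real_inner_le_norm y z
    rw [real_inner_comm y z]
    have h4 : ‖y‖⁻¹ * ⟪y, z⟫ ≤ ‖z‖ := by rw [inv_mul_le_iff₀ hyp]; exact h3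
    have h5 : ‖z‖⁻¹ * ⟪y, z⟫ ≤ ‖y‖ := by rw [inv_mul_le_iff₀ hzp, mul_comm]; exact h3
    have h6 : ‖y‖⁻¹ * ‖y‖ ^ 2 = ‖y‖ := by field_simp
    have h7 : ‖z‖⁻¹ * ‖z‖ ^ 2 = ‖z‖ := by field_simp
    rw [h6, h7]
    linarith
  nlinarith [mul_nonneg ha.pos.le h2]

/-- Monotonicity is applied to `k • ν` and `ξ`. Since `X` does not see the scale `k`, dividing by
`k` and letting it grow leaves the claim. -/
theorem inner_wulffMap_le_support (hF : IsEllipticIntegrand F) {ξ : Amb n} (hξ : ξ ≠ 0)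
    (ν : Amb n) : ⟪wulffMap F ξ, ν⟫ ≤ support F ν := by
  rcases eq_or_ne ν 0 with rfl | hν
  · simp [support]
  by_contra! hlt
  set d := ⟪wulffMap F ν - wulffMap F ξ, ξ⟫
  have hk : ∀ k : ℝ, 0 < k → d ≤ k * (support F ν - ⟪wulffMap F ξ, ν⟫) := by
    intro k hk
    have h := wulffMap_monotone hF (smul_ne_zero hk.ne' hν) hξ
    rw [wulffMap_smul hF hk hν, inner_sub_right, real_inner_smul_right, inner_sub_left,
      inner_wulffMap_self hF hν] at h
    linarith
  have hpos : 0 < ⟪wulffMap F ξ, ν⟫ - support F ν := by linarith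
  -- This `k` makes the right-hand side equal to `-(|d| + 1) < d`.
  have h := hk ((|d| + 1) / (⟪wulffMap F ξ, ν⟫ - support F ν)) (by positivity)
  have e : (|d| + 1) / (⟪wulffMap F ξ, ν⟫ - support F ν) * (support F ν - ⟪wulffMap F ξ, ν⟫) =
      -(|d| + 1) := by
    field_simp
    ring
  rw [e] at h
  linarith [neg_abs_le d]

/-- The quotient `⟨x, ξ⟩ / F(ξ)` attains its maximum on the compact sphere, and homogeneity extends
the bound to all `ν`. -/
theorem exists_dualGauge_eq (hF : IsEllipticIntegrand F) (x : Amb n) :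
    ∃ ξ : Sph n, ⟪x, (ξ : Amb n)⟫ = dualGauge F x * F ξ ∧
      ∀ ν : Amb n, ⟪x, ν⟫ ≤ dualGauge F x * support F ν := by
  have : Nonempty (Sph n) := (NormedSpace.sphere_nonempty.2 zero_le_one).to_subtype
  have hcont : Continuous fun ξ : Sph n => ⟪x, (ξ : Amb n)⟫ / F ξ :=
    (continuous_const.inner continuous_subtype_val).div hF.smooth.continuous
      fun ξ => (hF.pos ξ).ne'
  obtain ⟨ξ, -, hξ⟩ := isCompact_univ.exists_isMaxOn (Set.univ_nonempty (α := Sph n))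
    hcont.continuousOn
  replace hξ : ∀ η : Sph n, ⟪x, (η : Amb n)⟫ / F η ≤ ⟪x, (ξ : Amb n)⟫ / F ξ :=
    fun η => hξ (Set.mem_univ η)
  set m := ⟪x, (ξ : Amb n)⟫ / F ξ with hm
  -- One of `ξ` and `-ξ` pairs nonnegatively with `x`. The sign is needed because the constraint on
  -- `ν` is an inequality.
  have hm0 : 0 ≤ m := by
    rcases le_total 0 ⟪x, (ξ : Amb n)⟫ with h | h
    · exact div_nonneg h (hF.pos ξ).le
    · refine le_trans ?_ (hξ (-ξ))
      exact div_nonneg (by simpa using h) (hF.pos _).le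
  have hle : ∀ ν : Amb n, ⟪x, ν⟫ ≤ m * support F ν := by
    intro ν
    rcases eq_or_ne ν 0 with rfl | hν
    · simp [support]
    have hνp : 0 < ‖ν‖ := norm_pos_iff.2 hν
    have h := hξ ⟨‖ν‖⁻¹ • ν, inv_norm_smul_mem_sphere hν⟩
    rw [div_le_iff₀ (hF.pos _)] at h
    simp only [real_inner_smul_right] at h
    rw [inv_mul_le_iff₀ hνp] at h
    rw [support, homExt_of_ne_zero F hν]
    linarith
  have hN : dualGauge F x = m := by
    refine IsLUB.csSup_eq (a := m) ⟨?_, ?_⟩ ⟨0, 0, by simp, by simp⟩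
    · rintro t ⟨ν, hν, rfl⟩
      exact (hle ν).trans (mul_le_of_le_one_right hm0 hν)
    · intro b hb
      refine hb ⟨(F ξ)⁻¹ • (ξ : Amb n), ?_, ?_⟩
      · change support F _ ≤ 1
        rw [support_smul F (inv_pos.2 (hF.pos ξ)), support_coe, inv_mul_cancel₀ (hF.pos ξ).ne']
      · rw [real_inner_smul_right, hm]
        field_simp
  refine ⟨ξ, ?_, by rwa [hN]⟩
  rw [hN, hm, div_mul_cancel₀ _ (hF.pos ξ).ne']

/-- The contact direction `ξ` minimizes `F^*(x) h - ⟨x, ·⟩`, so the gradient of this function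
vanishes there. -/
theorem dualGauge_smul_wulffMap (hF : IsEllipticIntegrand F) {x : Amb n} {ξ : Sph n}
    (h1 : ⟪x, (ξ : Amb n)⟫ = dualGauge F x * F ξ)
    (h2 : ∀ ν : Amb n, ⟪x, ν⟫ ≤ dualGauge F x * support F ν) :
    dualGauge F x • wulffMap F ξ = x := by
  have hξ : (ξ : Amb n) ≠ 0 := ne_zero_of_mem_unit_sphere ξ
  have hmin : IsLocalMin (fun ν => dualGauge F x * support F ν - innerSL ℝ x ν) (ξ : Amb n) := by
    refine Filter.Eventually.of_forall fun ν => ?_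
    simp only [innerSL_apply_apply, h1, support_coe]
    linarith [h2 ν]
  have hd := ((hasGradientAt_support hF hξ).hasFDerivAt.const_mul (dualGauge F x)).sub
    (innerSL ℝ x).hasFDerivAt
  have h0 := hmin.hasFDerivAt_eq_zero hd
  refine ext_inner_right ℝ fun v => ?_
  have := congrArg (fun L => L v) h0
  simp [sub_eq_zero] at this
  rw [real_inner_smul_left, this]

theorem dualGauge_wulffMap (hF : IsEllipticIntegrand F) (ξ : Sph n) :
    dualGauge F (wulffMap F ξ) = 1 := by
  have hξ : (ξ : Amb n) ≠ 0 := ne_zero_of_mem_unit_sphere ξ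
  obtain ⟨η, h1, h2⟩ := exists_dualGauge_eq hF (wulffMap F ξ)
  have h3 := h2 ξ
  rw [inner_wulffMap_self hF hξ, support_coe] at h3
  have h4 := inner_wulffMap_le_support hF hξ η
  rw [h1, support_coe] at h4
  refine le_antisymm ?_ ?_
  · nlinarith [hF.pos η]
  · nlinarith [hF.pos ξ]

theorem shape_eq (hF : IsEllipticIntegrand F) :
    shape F = wulffMap F '' Metric.sphere (0 : Amb n) 1 := by
  ext x
  constructor
  · intro hx
    obtain ⟨ξ, h1, h2⟩ := exists_dualGauge_eq hF x
    have h3 := dualGauge_smul_wulffMap hF h1 h2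
    rw [show dualGauge F x = 1 from hx, one_smul] at h3
    exact ⟨ξ, ξ.2, h3⟩
  · rintro ⟨ξ, hξ, rfl⟩
    exact dualGauge_wulffMap hF ⟨ξ, hξ⟩

theorem abs_dualGauge_sub_le (hF : IsEllipticIntegrand F) (ha : IsConvexityConst F a)
    (x y : Amb n) : a * |dualGauge F x - dualGauge F y| ≤ ‖x - y‖ := by
  have key : ∀ x y : Amb n, a * (dualGauge F x - dualGauge F y) ≤ ‖x - y‖ := by
    intro x y
    obtain ⟨ξ, h1, -⟩ := exists_dualGauge_eq hF x
    obtain ⟨-, -, h2⟩ := exists_dualGauge_eq hF y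
    have h3 := h2 ξ
    rw [support_coe] at h3
    have h4 := real_inner_le_norm (x - y) (ξ : Amb n)
    rw [inner_sub_left, norm_eq_of_mem_sphere ξ, mul_one] at h4
    rcases le_total (dualGauge F x) (dualGauge F y) with h | h
    · exact le_trans (mul_nonpos_of_nonneg_of_nonpos ha.pos.le (by linarith)) (norm_nonneg _)
    · nlinarith [ha.le_apply ξ]
  rcases abs_cases (dualGauge F x - dualGauge F y) with ⟨h, -⟩ | ⟨h, -⟩
  · rw [h]; exact key x y
  · rw [h, neg_sub, norm_sub_rev]; exact key y x

/-- An envelope argument. With `p(ν) = ν / h(ν)` and `η(z)` a contact direction of `z`, the gauge is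
`⟨z, p(η(z))⟩` and dominates every `⟨z, p(ν)⟩`. The linearization error at `x` therefore lies
between `0` and `⟨z - x, p(η(z)) - p(ξ)⟩`, which is `o(|z - x|)` once `η(z) → ξ`. -/
theorem hasGradientAt_dualGauge (hF : IsEllipticIntegrand F) (ξ : Sph n) :
    HasGradientAt (dualGauge F) ((F ξ)⁻¹ • (ξ : Amb n)) (wulffMap F ξ) := by
  obtain ⟨a, ha⟩ := exists_isConvexityConst hF
  have hξ : (ξ : Amb n) ≠ 0 := ne_zero_of_mem_unit_sphere ξ
  set x := wulffMap F ξ with hx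
  have hNx : dualGauge F x = 1 := dualGauge_wulffMap hF ξ
  choose η hη1 hη2 using exists_dualGauge_eq hF
  have hpcont : ContinuousAt (fun y : Amb n => (support F y)⁻¹ • y) ξ :=
    ((contDiffAt_support hF hξ).continuousAt.inv₀ (support_pos hF hξ).ne').smul continuousAt_id
  have hhalf : ∀ᶠ z in nhds x, 1 / 2 ≤ dualGauge F z := by
    filter_upwards [Metric.ball_mem_nhds x (half_pos ha.pos)] with z hz
    have h := abs_dualGauge_sub_le hF ha z x
    rw [hNx] at h
    rw [Metric.mem_ball, dist_eq_norm] at hz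
    have : |dualGauge F z - 1| ≤ 1 / 2 := by
      refine le_of_mul_le_mul_left ?_ ha.pos
      linarith
    linarith [(abs_le.1 this).1]
  -- On unit vectors `X` agrees with `tubeMap`, so the expansion bound for the latter controls `η(z)
  -- - ξ` by the distance of the points `X(η(z)) = z / F^*(z)` and `x`.
  have hη : Filter.Tendsto (fun z => (η z : Amb n)) (nhds x) (nhds ξ) := by
    rw [tendsto_iff_norm_sub_tendsto_zero]
    have hb : Filter.Tendsto (fun z => 2 / a * (1 + ‖x‖ / a) * ‖z - x‖) (nhds x) (nhds 0) := by
      have : Continuous fun z : Amb n => 2 / a * (1 + ‖x‖ / a) * ‖z - x‖ := by fun_prop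
      simpa using this.tendsto x
    refine squeeze_zero' (Filter.Eventually.of_forall fun _ => norm_nonneg _) ?_ hb
    filter_upwards [hhalf] with z hz
    have h1 := tubeMap_antilipschitz hF ha (ne_zero_of_mem_unit_sphere (η z)) hξ
    rw [tubeMap_of_norm_eq_one hF a (norm_eq_of_mem_sphere _),
      tubeMap_of_norm_eq_one hF a (norm_eq_of_mem_sphere _), ← hx] at h1
    have h2 := dualGauge_smul_wulffMap hF (hη1 z) (hη2 z)
    have h3 : dualGauge F z • (wulffMap F (η z) - x) = (z - x) - (dualGauge F z - 1) • x := by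
      rw [smul_sub, h2]; module
    have h4 : dualGauge F z * ‖wulffMap F (η z) - x‖ ≤ ‖z - x‖ + ‖z - x‖ / a * ‖x‖ := by
      rw [← Real.norm_of_nonneg (by linarith : 0 ≤ dualGauge F z), ← norm_smul, h3]
      refine (norm_sub_le _ _).trans ?_
      rw [norm_smul]
      gcongr
      rw [le_div_iff₀ ha.pos, mul_comm, Real.norm_eq_abs, ← hNx]
      exact abs_dualGauge_sub_le hF ha z x
    have h5 : a * ‖(η z : Amb n) - ξ‖ ≤ 2 * (‖z - x‖ + ‖z - x‖ / a * ‖x‖) := by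
      nlinarith [norm_nonneg (wulffMap F (η z) - x)]
    calc ‖(η z : Amb n) - ξ‖ ≤ 2 * (‖z - x‖ + ‖z - x‖ / a * ‖x‖) / a := by
          rw [le_div_iff₀ ha.pos]; linarith
      _ = _ := by ring
  rw [hasGradientAt_iff_isLittleO, Asymptotics.isLittleO_iff]
  intro ε hε
  have hp := hpcont.tendsto.comp hη
  filter_upwards [hp (Metric.ball_mem_nhds _ hε)] with z hz
  simp only [Set.mem_preimage, Function.comp, Metric.mem_ball, dist_eq_norm, support_coe] at hz
  have hFξ := hF.pos ξ
  have hFη := hF.pos (η z)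
  have e1 : dualGauge F z = ⟪z, (F (η z))⁻¹ • (η z : Amb n)⟫ := by
    rw [real_inner_smul_right, hη1 z]; field_simp
  have e2 : ⟪x, (F ξ)⁻¹ • (ξ : Amb n)⟫ = 1 := by
    rw [real_inner_smul_right, hx, inner_wulffMap_self hF hξ, support_coe]; field_simp
  have e3 : ⟪x, (F (η z))⁻¹ • (η z : Amb n)⟫ ≤ 1 := by
    rw [real_inner_smul_right, inv_mul_le_iff₀ hFη, mul_one, ← support_coe F]
    exact inner_wulffMap_le_support hF hξ _
  have e4 : ⟪z, (F ξ)⁻¹ • (ξ : Amb n)⟫ ≤ dualGauge F z := by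
    rw [real_inner_smul_right, inv_mul_le_iff₀ hFξ, ← support_coe F, mul_comm]
    exact hη2 z ξ
  rw [hNx, Real.norm_eq_abs, real_inner_comm, inner_sub_left, e2, abs_of_nonneg (by linarith)]
  have e5 := (real_inner_le_norm (z - x) ((F (η z))⁻¹ • (η z : Amb n) - (F ξ)⁻¹ • (ξ : Amb n)))
  have e6 : ‖z - x‖ * ‖(F (η z))⁻¹ • (η z : Amb n) - (F ξ)⁻¹ • (ξ : Amb n)‖ ≤ ‖z - x‖ * ε := by
    gcongr
  simp only [inner_sub_left, inner_sub_right] at e5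
  linarith

theorem normal_wulffMap (hF : IsEllipticIntegrand F) {ξ : Amb n} (hξ : ‖ξ‖ = 1) :
    normal F (wulffMap F ξ) = ξ := by
  obtain ⟨η, rfl⟩ : ∃ η : Sph n, (η : Amb n) = ξ := ⟨⟨ξ, by simpa using hξ⟩, rfl⟩
  have h := (hasGradientAt_dualGauge hF η).gradient
  have hp := hF.pos η
  rw [normal, h, norm_smul, hξ, mul_one, norm_inv, Real.norm_of_nonneg hp.le, inv_inv, smul_smul,
    mul_inv_cancel₀ hp.ne', one_smul]

/-! ### The tube and the inverse of the normal coordinates -/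

/-- The neighbourhood of the Wulff shape that is covered by the normal coordinates. -/
def tube (F : Sph n → ℝ) (a : ℝ) : Set (Amb n) := tubeMap F a '' {0}ᶜ

/-- The inverse of the normal coordinate map. -/
def tubeInv (F : Sph n → ℝ) (a : ℝ) : Amb n → Amb n := Function.invFunOn (tubeMap F a) {0}ᶜ

theorem tubeInv_ne_zero {z : Amb n} (hz : z ∈ tube F a) : tubeInv F a z ≠ 0 :=
  Function.invFunOn_mem hz

theorem tubeMap_tubeInv {z : Amb n} (hz : z ∈ tube F a) : tubeMap F a (tubeInv F a z) = z :=
  Function.invFunOn_eq hz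

theorem tubeMap_mem_tube {y : Amb n} (hy : y ≠ 0) : tubeMap F a y ∈ tube F a := ⟨y, hy, rfl⟩

theorem tubeMap_injOn (hF : IsEllipticIntegrand F) (ha : IsConvexityConst F a) :
    Set.InjOn (tubeMap F a) {0}ᶜ := by
  intro y hy z hz h
  have := tubeMap_antilipschitz hF ha hy hz
  rw [h, sub_self, norm_zero] at this
  have h0 : ‖y - z‖ ≤ 0 := by nlinarith [ha.pos]
  exact sub_eq_zero.1 (norm_le_zero_iff.1 h0)

theorem tubeInv_tubeMap (hF : IsEllipticIntegrand F) (ha : IsConvexityConst F a) {y : Amb n}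
    (hy : y ≠ 0) : tubeInv F a (tubeMap F a y) = y :=
  tubeMap_injOn hF ha (tubeInv_ne_zero (tubeMap_mem_tube hy)) hy
    (tubeMap_tubeInv (tubeMap_mem_tube hy))

theorem tubeInv_lipschitz (hF : IsEllipticIntegrand F) (ha : IsConvexityConst F a) {z w : Amb n}
    (hz : z ∈ tube F a) (hw : w ∈ tube F a) :
    a * ‖tubeInv F a z - tubeInv F a w‖ ≤ ‖z - w‖ := by
  have := tubeMap_antilipschitz hF ha (tubeInv_ne_zero hz) (tubeInv_ne_zero hw)
  rwa [tubeMap_tubeInv hz, tubeMap_tubeInv hw] at this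

theorem norm_le_norm_fderiv_tubeMap (hF : IsEllipticIntegrand F) (ha : IsConvexityConst F a)
    {y : Amb n} (hy : y ≠ 0) (v : Amb n) : a * ‖v‖ ≤ ‖fderiv ℝ (tubeMap F a) y v‖ := by
  rcases eq_or_ne v 0 with rfl | hv
  · simp
  have h1 := coercive_tubeMap hF ha hy v
  have h2 := real_inner_le_norm (fderiv ℝ (tubeMap F a) y v) v
  refine le_of_mul_le_mul_right ?_ (norm_pos_iff.2 hv)
  nlinarith

theorem exists_fderiv_tubeMap_equiv (hF : IsEllipticIntegrand F) (ha : IsConvexityConst F a)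
    {y : Amb n} (hy : y ≠ 0) :
    ∃ e : Amb n ≃L[ℝ] Amb n, (e : Amb n →L[ℝ] Amb n) = fderiv ℝ (tubeMap F a) y := by
  have hinj : Function.Injective (fderiv ℝ (tubeMap F a) y : Amb n →ₗ[ℝ] Amb n) := by
    refine (injective_iff_map_eq_zero _).2 fun v hv => ?_
    have := norm_le_norm_fderiv_tubeMap hF ha hy v
    rw [show fderiv ℝ (tubeMap F a) y v = 0 from hv, norm_zero] at this
    exact norm_le_zero_iff.1 (by nlinarith [ha.pos])
  refine ⟨(LinearEquiv.ofInjectiveEndo _ hinj).toContinuousLinearEquiv, ?_⟩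
  ext1 v
  rfl

/-- Coercivity makes the derivative invertible, so the inverse function theorem applies; global
injectivity identifies its local inverse with `tubeInv`. -/
theorem tube_mem_nhds_and_contDiffAt_tubeInv (hF : IsEllipticIntegrand F) (ha : IsConvexityConst F a)
    {y : Amb n} (hy : y ≠ 0) :
    tube F a ∈ nhds (tubeMap F a y) ∧ ContDiffAt ℝ ∞ (tubeInv F a) (tubeMap F a y) := by
  obtain ⟨e, he⟩ := exists_fderiv_tubeMap_equiv hF ha hy
  have hc := contDiffAt_tubeMap hF a hy
  have hd : HasFDerivAt (tubeMap F a) (e : Amb n →L[ℝ] Amb n) y := by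
    rw [he]; exact hasFDerivAt_tubeMap hF a hy
  have hs : HasStrictFDerivAt (tubeMap F a) (e : Amb n →L[ℝ] Amb n) y :=
    hc.hasStrictFDerivAt' hd (by simp)
  have hg : ContDiffAt ℝ ∞ (hc.localInverse hd (by simp)) (tubeMap F a y) :=
    hc.to_localInverse hd (by simp)
  have hgy : hc.localInverse hd (by simp) (tubeMap F a y) = y :=
    hc.localInverse_apply_image hd (by simp)
  have hr : ∀ᶠ z in nhds (tubeMap F a y), tubeMap F a (hc.localInverse hd (by simp) z) = z :=
    hs.eventually_right_inverse
  have hne : ∀ᶠ z in nhds (tubeMap F a y), hc.localInverse hd (by simp) z ≠ 0 := by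
    refine hg.continuousAt.eventually_ne ?_
    rwa [hgy]
  constructor
  · filter_upwards [hr, hne] with z h1 h2
    exact ⟨_, h2, h1⟩
  · refine hg.congr_of_eventuallyEq ?_
    filter_upwards [hr, hne] with z h1 h2
    conv_lhs => rw [← h1]
    exact tubeInv_tubeMap hF ha h2

theorem isOpen_tube (hF : IsEllipticIntegrand F) (ha : IsConvexityConst F a) :
    IsOpen (tube F a) := by
  rw [isOpen_iff_mem_nhds]
  rintro _ ⟨y, hy, rfl⟩
  exact (tube_mem_nhds_and_contDiffAt_tubeInv hF ha hy).1

theorem contDiffAt_tubeInv (hF : IsEllipticIntegrand F) (ha : IsConvexityConst F a) {z : Amb n}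
    (hz : z ∈ tube F a) : ContDiffAt ℝ ∞ (tubeInv F a) z := by
  obtain ⟨y, hy, rfl⟩ := hz
  exact (tube_mem_nhds_and_contDiffAt_tubeInv hF ha hy).2

theorem hasFDerivAt_tubeInv (hF : IsEllipticIntegrand F) (ha : IsConvexityConst F a) {z : Amb n}
    (hz : z ∈ tube F a) : HasFDerivAt (tubeInv F a) (fderiv ℝ (tubeInv F a) z) z :=
  ((contDiffAt_tubeInv hF ha hz).differentiableAt (by simp)).hasFDerivAt

theorem fderiv_tubeMap_fderiv_tubeInv (hF : IsEllipticIntegrand F) (ha : IsConvexityConst F a)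
    {z : Amb n} (hz : z ∈ tube F a) (v : Amb n) :
    fderiv ℝ (tubeMap F a) (tubeInv F a z) (fderiv ℝ (tubeInv F a) z v) = v := by
  have h1 := (hasFDerivAt_tubeMap hF a (tubeInv_ne_zero hz)).comp z (hasFDerivAt_tubeInv hF ha hz)
  have h2 : HasFDerivAt (tubeMap F a ∘ tubeInv F a) (ContinuousLinearMap.id ℝ (Amb n)) z := by
    refine (hasFDerivAt_id z).congr_of_eventuallyEq ?_
    filter_upwards [(isOpen_tube hF ha).mem_nhds hz] with w hw
    exact tubeMap_tubeInv hw
  exact congrArg (fun L => L v) (h1.unique h2)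

theorem norm_fderiv_tubeInv_le (hF : IsEllipticIntegrand F) (ha : IsConvexityConst F a)
    {z : Amb n} (hz : z ∈ tube F a) (v : Amb n) : a * ‖fderiv ℝ (tubeInv F a) z v‖ ≤ ‖v‖ := by
  have := norm_le_norm_fderiv_tubeMap hF ha (tubeInv_ne_zero hz) (fderiv ℝ (tubeInv F a) z v)
  rwa [fderiv_tubeMap_fderiv_tubeInv hF ha hz] at this

/-- The function `a * (|Y z| - 1)`, where `Y` is the inverse of the normal coordinate map, is the
signed distance from the Wulff shape, and its gradient is the normal. -/
theorem hasFDerivAt_signedDist (hF : IsEllipticIntegrand F) (ha : IsConvexityConst F a)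
    {z : Amb n} (hz : z ∈ tube F a) :
    HasFDerivAt (fun z => a * (‖tubeInv F a z‖ - 1))
      (innerSL ℝ (‖tubeInv F a z‖⁻¹ • tubeInv F a z)) z := by
  have hy := tubeInv_ne_zero hz
  have h := (((hasGradientAt_norm hy).hasFDerivAt.comp z (hasFDerivAt_tubeInv hF ha hz)).sub_const
    1).const_mul a
  refine h.congr_fderiv ?_
  ext1 v
  have h1 := inner_fderiv_tubeMap hF a hy (fderiv ℝ (tubeInv F a) z v)
  rw [fderiv_tubeMap_fderiv_tubeInv hF ha hz] at h1
  simp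
  rw [real_inner_comm, mul_left_comm, ← h1, real_inner_comm]

theorem wulffMap_mem_shape (hF : IsEllipticIntegrand F) {y : Amb n} (hy : y ≠ 0) :
    wulffMap F y ∈ shape F := by
  rw [shape_eq hF, ← wulffMap_smul hF (inv_pos.2 (norm_pos_iff.2 hy)) hy]
  exact ⟨_, inv_norm_smul_mem_sphere hy, rfl⟩

theorem exists_eq_wulffMap (hF : IsEllipticIntegrand F) {x : Amb n} (hx : x ∈ shape F) :
    ∃ ξ : Amb n, ‖ξ‖ = 1 ∧ ξ ≠ 0 ∧ x = wulffMap F ξ := by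
  rw [shape_eq hF] at hx
  obtain ⟨ξ, hξ, rfl⟩ := hx
  have h1 : ‖ξ‖ = 1 := by simpa using hξ
  exact ⟨ξ, h1, norm_ne_zero_iff.1 (by rw [h1]; exact one_ne_zero), rfl⟩

theorem wulffMap_mem_tube (hF : IsEllipticIntegrand F) (a : ℝ) {ξ : Amb n} (hξ : ‖ξ‖ = 1) :
    wulffMap F ξ ∈ tube F a := by
  rw [← tubeMap_of_norm_eq_one hF a hξ]
  exact tubeMap_mem_tube (norm_ne_zero_iff.1 (by rw [hξ]; exact one_ne_zero))

theorem tubeInv_wulffMap (hF : IsEllipticIntegrand F) (ha : IsConvexityConst F a) {ξ : Amb n}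
    (hξ : ‖ξ‖ = 1) : tubeInv F a (wulffMap F ξ) = ξ := by
  rw [← tubeMap_of_norm_eq_one hF a hξ]
  exact tubeInv_tubeMap hF ha (norm_ne_zero_iff.1 (by rw [hξ]; exact one_ne_zero))

theorem shape_subset_tube (hF : IsEllipticIntegrand F) (a : ℝ) : shape F ⊆ tube F a := by
  intro x hx
  obtain ⟨ξ, hξ, -, rfl⟩ := exists_eq_wulffMap hF hx
  exact wulffMap_mem_tube hF a hξ

theorem normal_eq_tubeInv (hF : IsEllipticIntegrand F) (ha : IsConvexityConst F a) {x : Amb n}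
    (hx : x ∈ shape F) : normal F x = tubeInv F a x := by
  obtain ⟨ξ, hξ, -, rfl⟩ := exists_eq_wulffMap hF hx
  rw [normal_wulffMap hF hξ, tubeInv_wulffMap hF ha hξ]

theorem norm_normal (hF : IsEllipticIntegrand F) {x : Amb n} (hx : x ∈ shape F) :
    ‖normal F x‖ = 1 := by
  obtain ⟨ξ, hξ, -, rfl⟩ := exists_eq_wulffMap hF hx
  rw [normal_wulffMap hF hξ, hξ]

/-- The point of the tube at signed distance `t > -a` over `wulffMap F ξ`. -/
theorem normal_coordinates (hF : IsEllipticIntegrand F) (ha : IsConvexityConst F a) {ξ : Amb n}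
    (hξ : ‖ξ‖ = 1) {t : ℝ} (ht : -a < t) :
    wulffMap F ξ + t • ξ ∈ tube F a ∧ tubeInv F a (wulffMap F ξ + t • ξ) = (1 + t / a) • ξ := by
  have hξ0 : ξ ≠ 0 := norm_ne_zero_iff.1 (by rw [hξ]; exact one_ne_zero)
  have hap := ha.pos
  have hr : 0 < 1 + t / a := by
    have : (1 + t / a) = (a + t) / a := by field_simp
    rw [this]
    exact div_pos (by linarith) hap
  have h := tubeMap_smul hF a hr hξ
  rw [show a * (1 + t / a - 1) = t by field_simp; ring] at h
  have hne := smul_ne_zero hr.ne' hξ0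
  rw [← h]
  exact ⟨tubeMap_mem_tube hne, tubeInv_tubeMap hF ha hne⟩

/-! ### Smooth functions and the `C¹` norm on the Wulff shape -/

theorem isCompact_shape (hF : IsEllipticIntegrand F) : IsCompact (shape F) := by
  rw [shape_eq hF]
  refine (isCompact_sphere _ _).image_of_continuousOn fun ξ hξ => ?_
  exact (contDiffAt_wulffMap hF
    (ne_zero_of_mem_unit_sphere ⟨ξ, hξ⟩)).continuousAt.continuousWithinAt

theorem shape_nonempty (hF : IsEllipticIntegrand F) : (shape F).Nonempty := by
  rw [shape_eq hF]
  exact (NormedSpace.sphere_nonempty.2 zero_le_one).image _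

theorem continuousOn_normal (hF : IsEllipticIntegrand F) : ContinuousOn (normal F) (shape F) := by
  obtain ⟨a, ha⟩ := exists_isConvexityConst hF
  refine ContinuousOn.congr (f := tubeInv F a) (fun x hx => ?_) fun x hx =>
    normal_eq_tubeInv hF ha hx
  exact (contDiffAt_tubeInv hF ha
    (shape_subset_tube hF a hx)).continuousAt.continuousWithinAt

theorem SmoothOnSet.continuousOn {V : Type*} [NormedAddCommGroup V] [NormedSpace ℝ V]
    {f : Amb n → V} {S : Set (Amb n)} (hf : SmoothOnSet f S) : ContinuousOn f S := by
  intro x hx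
  obtain ⟨U, g, hU, hxU, hg, hfg⟩ := hf x hx
  have h1 : ContinuousWithinAt g (S ∩ U) x :=
    ((hg.contDiffAt (hU.mem_nhds hxU)).continuousAt).continuousWithinAt
  have h2 : ContinuousWithinAt f (S ∩ U) x := h1.congr hfg (hfg ⟨hx, hxU⟩)
  exact (continuousWithinAt_inter (hU.mem_nhds hxU)).1 h2

theorem SmoothOnSet.differentiableWithinAt {u : Amb n → ℝ} {S : Set (Amb n)}
    (hu : SmoothOnSet u S) {x : Amb n} (hx : x ∈ S) : DifferentiableWithinAt ℝ u S x := by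
  obtain ⟨U, g, hU, hxU, hg, hfg⟩ := hu x hx
  have h1 : DifferentiableWithinAt ℝ g (S ∩ U) x :=
    ((hg.contDiffAt (hU.mem_nhds hxU)).differentiableAt (by simp)).differentiableWithinAt
  have h2 : DifferentiableWithinAt ℝ u (S ∩ U) x := h1.congr hfg (hfg ⟨hx, hxU⟩)
  exact (differentiableWithinAt_inter (hU.mem_nhds hxU)).1 h2

theorem SmoothOnSet.contDiffAt_comp_wulffMap (hF : IsEllipticIntegrand F) {u : Amb n → ℝ}
    (hu : SmoothOnSet u (shape F)) {y : Amb n} (hy : y ≠ 0) :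
    ContDiffAt ℝ ∞ (fun z => u (wulffMap F z)) y := by
  obtain ⟨U, g, hU, hxU, hg, hfg⟩ := hu _ (wulffMap_mem_shape hF hy)
  have hX := contDiffAt_wulffMap hF hy
  refine ((hg.contDiffAt (hU.mem_nhds hxU)).comp y hX).congr_of_eventuallyEq ?_
  filter_upwards [hX.continuousAt.preimage_mem_nhds (hU.mem_nhds hxU),
    isOpen_ne.mem_nhds hy] with z h1 h2
  exact hfg ⟨wulffMap_mem_shape hF h2, h1⟩

/-- Extending `f` constantly along the normals, through the foot point map, gives a smooth function
on the tube. -/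
theorem smoothOnSet_of_comp_wulffMap (hF : IsEllipticIntegrand F) {V : Type*}
    [NormedAddCommGroup V] [NormedSpace ℝ V] {f : Amb n → V}
    (hf : ∀ y : Amb n, y ≠ 0 → ContDiffAt ℝ ∞ (fun z => f (wulffMap F z)) y) :
    SmoothOnSet f (shape F) := by
  obtain ⟨a, ha⟩ := exists_isConvexityConst hF
  intro x hx
  refine ⟨tube F a, fun z => f (wulffMap F (tubeInv F a z)), isOpen_tube hF ha,
    shape_subset_tube hF a hx, fun z hz => ?_, ?_⟩
  · exact ((hf _ (tubeInv_ne_zero hz)).comp z (contDiffAt_tubeInv hF ha hz)).contDiffWithinAt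
  · rintro z ⟨hz, -⟩
    obtain ⟨ξ, hξ, -, rfl⟩ := exists_eq_wulffMap hF hz
    simp only [tubeInv_wulffMap hF ha hξ]

/-- A derivative within a hypersurface is determined only up to its normal component. The derivative
of `X` takes tangential values, so that component drops out. -/
theorem hasFDerivAt_comp_wulffMap (hF : IsEllipticIntegrand F) {u : Amb n → ℝ}
    (hu : SmoothOnSet u (shape F)) {y : Amb n} (hy : y ≠ 0) :
    HasFDerivAt (fun z => u (wulffMap F z))
      ((innerSL ℝ (tangentialGradient F u (wulffMap F y))).comp (fderiv ℝ (wulffMap F) y)) y := by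
  have hx := wulffMap_mem_shape hF hy
  have h1 := (hu.differentiableWithinAt hx).hasGradientWithinAt.hasFDerivWithinAt
  have h2 := h1.comp_hasFDerivAt_of_eq y (hasFDerivAt_wulffMap hF hy)
    (by filter_upwards [isOpen_ne.mem_nhds hy] with z hz using wulffMap_mem_shape hF hz) rfl
  refine HasFDerivAt.congr_fderiv (f := fun z => u (wulffMap F z)) h2 ?_
  ext1 v
  have h3 : ⟪normal F (wulffMap F y), fderiv ℝ (wulffMap F) y v⟫ = 0 := by
    have hp := norm_pos_iff.2 hy
    rw [← wulffMap_smul hF (inv_pos.2 hp) hy, normal_wulffMap hF (by simp [norm_smul, hp.ne']),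
      real_inner_smul_left, real_inner_comm, inner_fderiv_wulffMap hF hy, mul_zero]
  simp [tangentialGradient, h3]

theorem inner_normal_tangentialGradient (hF : IsEllipticIntegrand F) (u : Amb n → ℝ) {x : Amb n}
    (hx : x ∈ shape F) : ⟪normal F x, tangentialGradient F u x⟫ = 0 := by
  rw [tangentialGradient, inner_sub_right, real_inner_smul_right, real_inner_self_eq_norm_sq,
    norm_normal hF hx]
  ring

/-- With `p` the gradient, take `v` with `DΨ(ξ) v = p`. Since `p ⊥ ξ`, also `v ⊥ ξ`, and then `DX(ξ)
v = p`. The derivative of `u ∘ X` along `v` is `|p|²`, while `a|v| ≤ |p|`. -/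
theorem norm_tangentialGradient_le (hF : IsEllipticIntegrand F) (ha : IsConvexityConst F a)
    {u : Amb n → ℝ} (hu : SmoothOnSet u (shape F)) {ξ : Amb n} (hξ : ‖ξ‖ = 1) :
    a * ‖tangentialGradient F u (wulffMap F ξ)‖ ≤ ‖fderiv ℝ (fun z => u (wulffMap F z)) ξ‖ := by
  have hξ0 : ξ ≠ 0 := norm_ne_zero_iff.1 (by rw [hξ]; exact one_ne_zero)
  have hx := wulffMap_mem_shape hF hξ0
  set p := tangentialGradient F u (wulffMap F ξ) with hp
  have hpξ : ⟪ξ, p⟫ = 0 := by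
    have := inner_normal_tangentialGradient hF u hx
    rwa [normal_wulffMap hF hξ] at this
  have htube := wulffMap_mem_tube hF a hξ
  set v := fderiv ℝ (tubeInv F a) (wulffMap F ξ) p with hv
  have h1 := fderiv_tubeMap_fderiv_tubeInv hF ha htube p
  have h2 := norm_fderiv_tubeInv_le hF ha htube p
  rw [tubeInv_wulffMap hF ha hξ, ← hv] at h1
  have h3 : ⟪v, ξ⟫ = 0 := by
    have := inner_fderiv_tubeMap hF a hξ0 v
    rw [h1, real_inner_comm, hpξ] at this
    exact (mul_eq_zero.1 this.symm).resolve_left ha.pos.ne'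
  rw [fderiv_tubeMap_apply hF a hξ0, hξ, real_inner_comm, h3] at h1
  have h4 : fderiv ℝ (wulffMap F) ξ v = p := by simpa using h1
  have h5 := (hasFDerivAt_comp_wulffMap hF hu hξ0).fderiv
  have h6 : fderiv ℝ (fun z => u (wulffMap F z)) ξ v = ‖p‖ ^ 2 := by
    rw [h5]
    simp [h4, ← hp]
  have h7 := (fderiv ℝ (fun z => u (wulffMap F z)) ξ).le_opNorm v
  rw [h6, Real.norm_of_nonneg (by positivity)] at h7
  rcases eq_or_ne p 0 with h0 | h0
  · rw [h0]; simp
  refine le_of_mul_le_mul_right ?_ (norm_pos_iff.2 h0)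
  calc a * ‖p‖ * ‖p‖ = a * ‖p‖ ^ 2 := by ring
    _ ≤ a * (‖fderiv ℝ (fun z => u (wulffMap F z)) ξ‖ * ‖v‖) :=
        mul_le_mul_of_nonneg_left h7 ha.pos.le
    _ = ‖fderiv ℝ (fun z => u (wulffMap F z)) ξ‖ * (a * ‖v‖) := by ring
    _ ≤ _ := by gcongr

/-- Without boundedness the real supremum in `C1norm` would be `0` by convention and would control
nothing. -/
theorem bddAbove_tangentialGradient (hF : IsEllipticIntegrand F) {u : Amb n → ℝ}
    (hu : SmoothOnSet u (shape F)) :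
    BddAbove (Set.range fun x : shape F => ‖tangentialGradient F u x‖) := by
  obtain ⟨a, ha⟩ := exists_isConvexityConst hF
  have hc : ContinuousOn (fun ξ => ‖fderiv ℝ (fun z => u (wulffMap F z)) ξ‖)
      (Metric.sphere (0 : Amb n) 1) := fun ξ hξ =>
    (((hu.contDiffAt_comp_wulffMap hF (ne_zero_of_mem_unit_sphere ⟨ξ, hξ⟩)).fderiv_right
      (m := ∞) (by simp)).continuousAt.norm).continuousWithinAt
  obtain ⟨B, hB⟩ := (isCompact_sphere (0 : Amb n) 1).bddAbove_image hc
  refine ⟨B / a, ?_⟩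
  rintro _ ⟨⟨x, hx⟩, rfl⟩
  obtain ⟨ξ, hξ, -, rfl⟩ := exists_eq_wulffMap hF hx
  simp only
  rw [le_div_iff₀ ha.pos, mul_comm]
  exact (norm_tangentialGradient_le hF ha hu hξ).trans
    (hB ⟨ξ, by simpa using hξ, rfl⟩)

theorem bddAbove_abs (hF : IsEllipticIntegrand F) {u : Amb n → ℝ}
    (hu : SmoothOnSet u (shape F)) : BddAbove (Set.range fun x : shape F => |u x|) := by
  obtain ⟨B, hB⟩ := (isCompact_shape hF).bddAbove_image hu.continuousOn.abs
  refine ⟨B, ?_⟩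
  rintro _ ⟨⟨x, hx⟩, rfl⟩
  exact hB ⟨x, hx, rfl⟩

theorem abs_le_C1norm (hF : IsEllipticIntegrand F) {u : Amb n → ℝ}
    (hu : SmoothOnSet u (shape F)) {x : Amb n} (hx : x ∈ shape F) : |u x| ≤ C1norm F u := by
  have h1 := le_ciSup (bddAbove_abs hF hu) ⟨x, hx⟩
  have h2 : 0 ≤ ⨆ x : shape F, ‖tangentialGradient F u x‖ :=
    Real.iSup_nonneg fun _ => norm_nonneg _
  exact h1.trans (le_add_of_nonneg_right h2)

theorem norm_tangentialGradient_le_C1norm (hF : IsEllipticIntegrand F) {u : Amb n → ℝ}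
    (hu : SmoothOnSet u (shape F)) {x : Amb n} (hx : x ∈ shape F) :
    ‖tangentialGradient F u x‖ ≤ C1norm F u := by
  have h1 := le_ciSup (bddAbove_tangentialGradient hF hu) ⟨x, hx⟩
  have h2 : 0 ≤ ⨆ x : shape F, |u x| := Real.iSup_nonneg fun _ => abs_nonneg _
  exact h1.trans (le_add_of_nonneg_left h2)

theorem C1norm_le {u : Amb n → ℝ} {b c : ℝ} (hb : 0 ≤ b) (hc : 0 ≤ c)
    (h1 : ∀ x ∈ shape F, |u x| ≤ b) (h2 : ∀ x ∈ shape F, ‖tangentialGradient F u x‖ ≤ c) :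
    C1norm F u ≤ b + c :=
  add_le_add (Real.iSup_le (fun x => h1 x x.2) hb) (Real.iSup_le (fun x => h2 x x.2) hc)

/-! ### Surface measure and the second moment of the normal -/

theorem contDiff_insertNth (i : Fin (n + 1)) (σ : ℝ) :
    ContDiff ℝ ∞ (fun q : Fin n → ℝ => (WithLp.toLp 2 (i.insertNth σ q : Fin (n + 1) → ℝ) :
      Amb n)) := by
  rw [contDiff_euclidean, Fin.forall_iff_succAbove i]
  constructor
  · simpa using contDiff_const
  · intro j
    simpa using contDiff_apply ℝ ℝ j

/-- As `X` is invariant under scaling, the faces of a cube can replace the sphere. The coordinate of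
largest modulus selects a face, and each face is a unit ball for the sup norm, on which `X` is
Lipschitz. -/
theorem hausdorffMeasure_shape_lt_top (hF : IsEllipticIntegrand F) :
    Measure.hausdorffMeasure (n : ℝ) (shape F) < ⊤ := by
  let f : Fin (n + 1) × Bool → (Fin n → ℝ) → Amb n := fun p q =>
    wulffMap F (WithLp.toLp 2 (p.1.insertNth (bif p.2 then (1 : ℝ) else -1) q : Fin (n + 1) → ℝ))
  have hcover : shape F ⊆ ⋃ p, f p '' Metric.closedBall 0 1 := by
    intro x hx
    obtain ⟨ξ, -, hξ0, rfl⟩ := exists_eq_wulffMap hF hx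
    obtain ⟨i, -, hi⟩ := Finset.exists_max_image Finset.univ (fun j => |ξ j|) ⟨0, Finset.mem_univ _⟩
    have hm : 0 < |ξ i| := by
      by_contra! h
      refine hξ0 ?_
      ext j
      exact abs_nonpos_iff.1 ((hi j (Finset.mem_univ j)).trans h)
    refine Set.mem_iUnion.2 ⟨(i, decide (0 < ξ i)), fun j => |ξ i|⁻¹ * ξ (i.succAbove j), ?_, ?_⟩
    · rw [mem_closedBall_zero_iff, pi_norm_le_iff_of_nonneg zero_le_one]
      intro j
      rw [norm_mul, norm_inv, Real.norm_eq_abs, Real.norm_eq_abs, abs_abs, inv_mul_le_iff₀ hm,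
        mul_one]
      exact hi _ (Finset.mem_univ _)
    · rw [← wulffMap_smul hF (inv_pos.2 hm) hξ0]
      simp only [f]
      congr 1
      ext j
      revert j
      rw [Fin.forall_iff_succAbove i]
      constructor
      · rcases lt_or_gt_of_ne (abs_pos.1 hm) with h | h
        · simp [h.not_gt, abs_of_neg h, h.ne, inv_neg]
        · simp [h, abs_of_pos h, h.ne']
      · intro j
        simp
  have hfin : ∀ p, Measure.hausdorffMeasure (n : ℝ) (f p '' Metric.closedBall 0 1) < ⊤ := by
    intro p
    have hs : ContDiffOn ℝ ∞ (f p) (Metric.closedBall 0 1) := by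
      intro q _
      refine (ContDiffAt.comp q (contDiffAt_wulffMap hF fun h0 => ?_)
        (contDiff_insertNth p.1 _).contDiffAt).contDiffWithinAt
      have := congrArg (fun v : Amb n => v p.1) h0
      cases hp : p.2 <;> simp [hp] at this
    obtain ⟨K, hK⟩ := hs.exists_lipschitzOnWith (by simp) (convex_closedBall _ _)
      (isCompact_closedBall _ _)
    refine (hK.hausdorffMeasure_image_le n.cast_nonneg).trans_lt ?_
    refine ENNReal.mul_lt_top (ENNReal.rpow_lt_top_of_nonneg n.cast_nonneg (by simp)) ?_
    have h := hausdorffMeasure_pi_real (ι := Fin n)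
    rw [Fintype.card_fin] at h
    rw [h]
    exact measure_closedBall_lt_top
  exact (measure_mono hcover).trans_lt
    ((measure_iUnion_le _).trans_lt (by
      rw [tsum_fintype]; exact ENNReal.sum_lt_top.2 fun p _ => hfin p))

/-- The normal followed by projection to `w^⊥` is Lipschitz and maps this part of the shape onto a
set containing the unit ball of an `n`-dimensional space. A null set has no such image. -/
theorem hausdorffMeasure_normal_pos (hF : IsEllipticIntegrand F) {w : Amb n} (hw : w ≠ 0) :
    0 < Measure.hausdorffMeasure (n : ℝ) {x ∈ shape F | 0 < ⟪w, normal F x⟫} := by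
  obtain ⟨a, ha⟩ := exists_isConvexityConst hF
  set A := {x ∈ shape F | 0 < ⟪w, normal F x⟫} with hA
  let P := (ℝ ∙ w)ᗮ.orthogonalProjectionOnto
  have hwp : 0 < ‖w‖ := norm_pos_iff.2 hw
  have hlip : LipschitzOnWith (Real.toNNReal a⁻¹) (fun x => P (tubeInv F a x)) A := by
    refine LipschitzOnWith.of_dist_le_mul fun x hx y hy => ?_
    rw [dist_eq_norm, dist_eq_norm, ← map_sub, Real.coe_toNNReal _ (inv_nonneg.2 ha.pos.le)]
    have h1 := tubeInv_lipschitz hF ha (shape_subset_tube hF a hx.1) (shape_subset_tube hF a hy.1)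
    have h2 : ‖P (tubeInv F a x - tubeInv F a y)‖ ≤ ‖tubeInv F a x - tubeInv F a y‖ := by
      refine (P.le_opNorm _).trans (mul_le_of_le_one_left (norm_nonneg _) ?_)
      exact Submodule.orthogonalProjectionOnto_norm_le _
    rw [inv_mul_eq_div, le_div_iff₀ ha.pos]
    nlinarith [ha.pos]
  have hball : Metric.ball (0 : (ℝ ∙ w)ᗮ) 1 ⊆ (fun x => P (tubeInv F a x)) '' A := by
    intro p hp
    rw [mem_ball_zero_iff] at hp
    have hpw : ⟪w, (p : Amb n)⟫ = 0 := Submodule.mem_orthogonal_singleton_iff_inner_right.1 p.2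
    have hs : 0 < 1 - ‖p‖ ^ 2 := by nlinarith [norm_nonneg p]
    -- The lift of `p` to the open unit hemisphere around `w`.
    set ξ : Amb n := (p : Amb n) + (Real.sqrt (1 - ‖p‖ ^ 2) * ‖w‖⁻¹) • w with hξdef
    have hξ : ‖ξ‖ = 1 := by
      have h1 : ‖ξ‖ ^ 2 = 1 := by
        rw [hξdef, norm_add_sq_real, real_inner_smul_right, real_inner_comm, hpw, norm_smul,
          norm_mul, norm_inv, norm_norm, Real.norm_of_nonneg (Real.sqrt_nonneg _),
          inv_mul_cancel_right₀ hwp.ne', Real.sq_sqrt hs.le, Submodule.coe_norm]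
        ring
      nlinarith [norm_nonneg ξ]
    have hξ0 : ξ ≠ 0 := norm_ne_zero_iff.1 (by rw [hξ]; exact one_ne_zero)
    refine ⟨wulffMap F ξ, ⟨wulffMap_mem_shape hF hξ0, ?_⟩, ?_⟩
    · rw [normal_wulffMap hF hξ, hξdef, inner_add_right, hpw, real_inner_smul_right,
        real_inner_self_eq_norm_sq]
      have := Real.sqrt_pos.2 hs
      positivity
    · simp only [tubeInv_wulffMap hF ha hξ]
      have h1 : P w = 0 := by
        refine Submodule.orthogonalProjectionOnto_apply_of_mem_orthogonal ?_
        rw [Submodule.orthogonal_orthogonal]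
        exact Submodule.mem_span_singleton_self w
      rw [hξdef, map_add, map_smul, h1, smul_zero, add_zero]
      exact Submodule.orthogonalProjectionOnto_mem_subspace_eq_self p
  have hfr : Module.finrank ℝ (ℝ ∙ w)ᗮ = n := by
    have : Fact (Module.finrank ℝ (Amb n) = n + 1) := ⟨finrank_euclideanSpace_fin⟩
    exact Submodule.finrank_orthogonal_span_singleton hw
  have hpos : 0 < Measure.hausdorffMeasure (n : ℝ) (Metric.ball (0 : (ℝ ∙ w)ᗮ) 1) := by
    have h := isAddHaarMeasure_hausdorffMeasure (E := (ℝ ∙ w)ᗮ)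
    rw [hfr] at h
    exact Metric.measure_ball_pos _ _ one_pos
  have h1 := (hpos.trans_le (measure_mono hball)).trans_le
    (hlip.hausdorffMeasure_image_le n.cast_nonneg)
  exact (ENNReal.mul_pos_iff.1 h1).2

/-- The surface measure of the Wulff shape. -/
def surfaceMeasure (F : Sph n → ℝ) : Measure (Amb n) :=
  (Measure.hausdorffMeasure (n : ℝ)).restrict (shape F)

theorem isFiniteMeasure_surfaceMeasure (hF : IsEllipticIntegrand F) :
    IsFiniteMeasure (surfaceMeasure F) :=
  ⟨by rw [surfaceMeasure, Measure.restrict_apply_univ]; exact hausdorffMeasure_shape_lt_top hF⟩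

theorem integrable_surfaceMeasure (hF : IsEllipticIntegrand F) {V : Type*}
    [NormedAddCommGroup V] [NormedSpace ℝ V] [SecondCountableTopology V] {f : Amb n → V}
    (hf : ContinuousOn f (shape F)) : Integrable f (surfaceMeasure F) := by
  have hm := (isCompact_shape hF).measurableSet
  obtain ⟨C, hC⟩ := (isCompact_shape hF).exists_bound_of_continuousOn hf
  have := isFiniteMeasure_surfaceMeasure hF
  refine Integrable.of_bound (hf.aestronglyMeasurable hm) C ?_
  exact (ae_restrict_iff' hm).2 (Filter.Eventually.of_forall hC)

/-- The second moment `∫ ν ⊗ ν` of the normal of the Wulff shape. -/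
def normalMoment (F : Sph n → ℝ) : Amb n →L[ℝ] Amb n :=
  ∫ x, (innerSL ℝ (normal F x)).smulRight (normal F x) ∂(surfaceMeasure F)

theorem integrable_normalMoment (hF : IsEllipticIntegrand F) :
    Integrable (fun x => (innerSL ℝ (normal F x)).smulRight (normal F x)) (surfaceMeasure F) := by
  refine integrable_surfaceMeasure hF ?_
  have h := continuousOn_normal hF
  exact ((ContinuousLinearMap.smulRightL ℝ (Amb n) (Amb n)).continuous.comp_continuousOn
    ((innerSL ℝ).continuous.comp_continuousOn h)).clm_apply h

theorem normalMoment_apply (hF : IsEllipticIntegrand F) (w : Amb n) :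
    normalMoment F w = ∫ x, ⟪normal F x, w⟫ • normal F x ∂(surfaceMeasure F) := by
  rw [normalMoment, ContinuousLinearMap.integral_apply (integrable_normalMoment hF)]
  simp

theorem inner_normalMoment_pos (hF : IsEllipticIntegrand F) {w : Amb n} (hw : w ≠ 0) :
    0 < ⟪w, normalMoment F w⟫ := by
  have hn := continuousOn_normal hF
  have h1 : Integrable (fun x => ⟪normal F x, w⟫ • normal F x) (surfaceMeasure F) :=
    integrable_surfaceMeasure hF (ContinuousOn.smul (f := fun x => ⟪normal F x, w⟫)
      (hn.inner continuousOn_const) hn)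
  have h2 : ⟪w, normalMoment F w⟫ = ∫ x, ⟪normal F x, w⟫ ^ 2 ∂(surfaceMeasure F) := by
    rw [normalMoment_apply hF, ← integral_inner h1 w]
    congr 1
    ext x
    rw [real_inner_smul_right, real_inner_comm]
    ring
  rw [h2, integral_pos_iff_support_of_nonneg (fun x => sq_nonneg _)
    (integrable_surfaceMeasure hF ((hn.inner continuousOn_const).pow 2))]
  refine (hausdorffMeasure_normal_pos hF hw).trans_le ?_
  have hs : {x ∈ shape F | 0 < ⟪w, normal F x⟫} ⊆
      (Function.support fun x => ⟪normal F x, w⟫ ^ 2) ∩ shape F := by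
    rintro x ⟨hx, hpos⟩
    refine ⟨?_, hx⟩
    rw [real_inner_comm] at hpos
    exact pow_ne_zero 2 hpos.ne'
  rw [surfaceMeasure, Measure.restrict_apply' (isCompact_shape hF).measurableSet]
  exact measure_mono hs

theorem exists_normalMoment_equiv (hF : IsEllipticIntegrand F) :
    ∃ e : Amb n ≃L[ℝ] Amb n, (e : Amb n →L[ℝ] Amb n) = normalMoment F := by
  have hinj : Function.Injective (normalMoment F : Amb n →ₗ[ℝ] Amb n) := by
    refine (injective_iff_map_eq_zero _).2 fun v hv => ?_
    by_contra h0
    have := inner_normalMoment_pos hF h0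
    rw [show normalMoment F v = 0 from hv, inner_zero_right] at this
    exact lt_irrefl _ this
  refine ⟨(LinearEquiv.ofInjectiveEndo _ hinj).toContinuousLinearEquiv, ?_⟩
  ext1 v
  rfl

/-! ### The defining function of a radial graph -/

/-- A defining function of the radial graph of `u`: the signed distance from the Wulff shape minus
the radius over the foot point. -/
def levelFun (F : Sph n → ℝ) (a : ℝ) (u : Amb n → ℝ) (z : Amb n) : ℝ :=
  a * (‖tubeInv F a z‖ - 1) - u (wulffMap F (tubeInv F a z))

theorem exists_norm_fderiv_wulffMap_le (hF : IsEllipticIntegrand F) :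
    ∃ L, 0 < L ∧ ∀ y : Amb n, y ≠ 0 → ‖fderiv ℝ (wulffMap F) y‖ ≤ L * ‖y‖⁻¹ := by
  obtain ⟨L, hL⟩ := (isCompact_sphere (0 : Amb n) 1).exists_bound_of_continuousOn
    ((continuousOn_fderiv_wulffMap hF).mono fun ξ hξ => ne_zero_of_mem_unit_sphere ⟨ξ, hξ⟩)
  refine ⟨max L 1, by positivity, fun y hy => ?_⟩
  have hp := norm_pos_iff.2 hy
  have h := hL _ (inv_norm_smul_mem_sphere hy)
  rw [fderiv_wulffMap_smul hF (inv_pos.2 hp) hy, inv_inv, norm_smul, norm_norm] at h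
  rw [← div_eq_mul_inv, le_div_iff₀ hp, mul_comm]
  exact h.trans (le_max_left _ _)

theorem hasFDerivAt_levelFun (hF : IsEllipticIntegrand F) (ha : IsConvexityConst F a)
    (hu : SmoothOnSet u (shape F)) {z : Amb n} (hz : z ∈ tube F a) :
    HasFDerivAt (levelFun F a u)
      (innerSL ℝ (‖tubeInv F a z‖⁻¹ • tubeInv F a z) -
        ((innerSL ℝ (tangentialGradient F u (wulffMap F (tubeInv F a z)))).comp
          (fderiv ℝ (wulffMap F) (tubeInv F a z))).comp (fderiv ℝ (tubeInv F a) z)) z :=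
  (hasFDerivAt_signedDist hF ha hz).sub
    ((hasFDerivAt_comp_wulffMap hF hu (tubeInv_ne_zero hz)).comp z (hasFDerivAt_tubeInv hF ha hz))

theorem contDiffAt_levelFun (hF : IsEllipticIntegrand F) (ha : IsConvexityConst F a)
    (hu : SmoothOnSet u (shape F)) {z : Amb n} (hz : z ∈ tube F a) :
    ContDiffAt ℝ ∞ (levelFun F a u) z := by
  have h1 := contDiffAt_tubeInv hF ha hz
  have h2 := (hu.contDiffAt_comp_wulffMap hF (tubeInv_ne_zero hz)).comp z h1
  exact (contDiffAt_const.mul ((h1.norm ℝ (tubeInv_ne_zero hz)).sub contDiffAt_const)).sub h2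

/-- The signed distance has gradient `y/|y|` with `y = tubeInv F a z`. Here `y` is within `|z -
X(ξ)|/a ≤ 1/2` of `ξ`, whence the first term and `|y| ≥ 1/2`. The second term is the chain rule for
`u`, with factors `ε`, `2L` and `1/a`. -/
theorem norm_fderiv_levelFun_sub_le (hF : IsEllipticIntegrand F) (ha : IsConvexityConst F a)
    {L : ℝ} (hL0 : 0 < L) (hL : ∀ y : Amb n, y ≠ 0 → ‖fderiv ℝ (wulffMap F) y‖ ≤ L * ‖y‖⁻¹)
    (hu : SmoothOnSet u (shape F)) (hε : ∀ x ∈ shape F, ‖tangentialGradient F u x‖ ≤ ε)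
    {ξ z : Amb n} (hξ : ‖ξ‖ = 1) (hz : z ∈ tube F a) (hzξ : ‖z - wulffMap F ξ‖ ≤ a / 2) :
    ‖fderiv ℝ (levelFun F a u) z - innerSL ℝ ξ‖ ≤
      (2 / a) * ‖z - wulffMap F ξ‖ + (2 * L / a) * ε := by
  have hξt := wulffMap_mem_tube hF a hξ
  have hap := ha.pos
  set y := tubeInv F a z with hy
  have hy0 : y ≠ 0 := tubeInv_ne_zero hz
  have hyp : 0 < ‖y‖ := norm_pos_iff.2 hy0
  have hε0 : 0 ≤ ε := (norm_nonneg _).trans (hε _ (wulffMap_mem_shape hF hy0))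
  have h1 : a * ‖y - ξ‖ ≤ ‖z - wulffMap F ξ‖ := by
    have := tubeInv_lipschitz hF ha hz hξt
    rwa [tubeInv_wulffMap hF ha hξ] at this
  have h2 : ‖y - ξ‖ ≤ 1 / 2 := by
    refine le_of_mul_le_mul_left ?_ hap
    linarith
  have h3 : |‖y‖ - 1| ≤ ‖y - ξ‖ := by rw [← hξ]; exact abs_norm_sub_norm_le y ξ
  have h4 : 1 / 2 ≤ ‖y‖ := by linarith [(abs_le.1 h3).1]
  have h5 : ‖‖y‖⁻¹ • y - ξ‖ ≤ 2 * ‖y - ξ‖ := by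
    have e : ‖y‖⁻¹ • y - ξ = (‖y‖⁻¹ • y - y) + (y - ξ) := by abel
    have e2 : ‖‖y‖⁻¹ • y - y‖ = |‖y‖ - 1| := by
      rw [show ‖y‖⁻¹ • y - y = (‖y‖⁻¹ - 1) • y by module, norm_smul, Real.norm_eq_abs,
        ← abs_of_pos hyp, ← abs_mul, abs_of_pos hyp, sub_mul, inv_mul_cancel₀ hyp.ne', one_mul,
        abs_sub_comm]
    rw [e]
    linarith [norm_add_le (‖y‖⁻¹ • y - y) (y - ξ)]
  have h6 : ‖fderiv ℝ (wulffMap F) y‖ ≤ 2 * L := by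
    refine (hL y hy0).trans ?_
    rw [mul_comm]
    gcongr
    rw [inv_le_comm₀ hyp two_pos]
    linarith
  have h7 : ‖fderiv ℝ (tubeInv F a) z‖ ≤ 1 / a := by
    refine ContinuousLinearMap.opNorm_le_bound _ (by positivity) fun v => ?_
    rw [one_div, inv_mul_eq_div, le_div_iff₀ hap, mul_comm]
    exact norm_fderiv_tubeInv_le hF ha hz v
  rw [(hasFDerivAt_levelFun hF ha hu hz).fderiv, sub_right_comm, ← map_sub]
  refine (norm_sub_le _ _).trans (add_le_add ?_ ?_)
  · rw [innerSL_apply_norm]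
    refine h5.trans ?_
    rw [div_mul_eq_mul_div, le_div_iff₀ hap]
    linarith
  · calc _ ≤ ‖(innerSL ℝ (tangentialGradient F u (wulffMap F y))).comp
            (fderiv ℝ (wulffMap F) y)‖ * ‖fderiv ℝ (tubeInv F a) z‖ :=
          ContinuousLinearMap.opNorm_comp_le _ _
      _ ≤ (‖innerSL ℝ (tangentialGradient F u (wulffMap F y))‖ * ‖fderiv ℝ (wulffMap F) y‖) *
            ‖fderiv ℝ (tubeInv F a) z‖ := by
          gcongr
          exact ContinuousLinearMap.opNorm_comp_le _ _
      _ ≤ (ε * (2 * L)) * (1 / a) := by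
          rw [innerSL_apply_norm]
          gcongr
          exact hε _ (wulffMap_mem_shape hF hy0)
      _ = _ := by ring

/-- Constants for the geometry of the tube: balls of radius `r` around the Wulff shape lie in the
tube, and `K` controls the first derivatives. -/
structure IsTubeConst (F : Sph n → ℝ) (a r K : ℝ) : Prop where
  r_pos : 0 < r
  r_le : r ≤ a / 2
  K_pos : 0 < K
  ball_subset : ∀ ξ : Amb n, ‖ξ‖ = 1 → Metric.ball (wulffMap F ξ) r ⊆ tube F a
  norm_fderiv_wulffMap_le : ∀ ξ : Amb n, ‖ξ‖ = 1 → ‖fderiv ℝ (wulffMap F) ξ‖ ≤ K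
  norm_fderiv_levelFun_sub_le : ∀ (u : Amb n → ℝ) (ε : ℝ), SmoothOnSet u (shape F) →
    (∀ x ∈ shape F, ‖tangentialGradient F u x‖ ≤ ε) →
    ∀ ξ z : Amb n, ‖ξ‖ = 1 → ‖z - wulffMap F ξ‖ < r →
      ‖fderiv ℝ (levelFun F a u) z - innerSL ℝ ξ‖ ≤ K * (‖z - wulffMap F ξ‖ + ε)

theorem exists_isTubeConst (hF : IsEllipticIntegrand F) (ha : IsConvexityConst F a) :
    ∃ r K, IsTubeConst F a r K := by
  obtain ⟨L, hL0, hL⟩ := exists_norm_fderiv_wulffMap_le hF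
  obtain ⟨δ, hδ, hsub⟩ := (isCompact_shape hF).exists_thickening_subset_open
    (isOpen_tube hF ha) (shape_subset_tube hF a)
  have hap := ha.pos
  have hball : ∀ ξ : Amb n, ‖ξ‖ = 1 → Metric.ball (wulffMap F ξ) (min δ (a / 2)) ⊆ tube F a := by
    intro ξ hξ
    have hξ0 : ξ ≠ 0 := norm_ne_zero_iff.1 (by rw [hξ]; exact one_ne_zero)
    refine Set.Subset.trans ?_ hsub
    exact (Metric.ball_subset_ball (min_le_left _ _)).trans
      (Metric.ball_subset_thickening (wulffMap_mem_shape hF hξ0) _)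
  refine ⟨min δ (a / 2), max L (max (2 / a) (2 * L / a)), by positivity, min_le_right _ _,
    lt_max_of_lt_left hL0, hball, fun ξ hξ => ?_, fun u ε hu hε ξ z hξ hz => ?_⟩
  · have hξ0 : ξ ≠ 0 := norm_ne_zero_iff.1 (by rw [hξ]; exact one_ne_zero)
    have := hL ξ hξ0
    rw [hξ, inv_one, mul_one] at this
    exact this.trans (le_max_left _ _)
  · have hξ0 : ξ ≠ 0 := norm_ne_zero_iff.1 (by rw [hξ]; exact one_ne_zero)
    have hε0 : 0 ≤ ε := (norm_nonneg _).trans (hε _ (wulffMap_mem_shape hF hξ0))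
    have hzt : z ∈ tube F a := hball ξ hξ (by rwa [Metric.mem_ball, dist_eq_norm])
    refine (norm_fderiv_levelFun_sub_le hF ha hL0 hL hu hε hξ hzt
      (hz.le.trans (min_le_right _ _))).trans ?_
    rw [mul_add]
    gcongr
    · exact (le_max_left _ _).trans (le_max_right _ _)
    · exact (le_max_right _ _).trans (le_max_right _ _)

/-- The function `u` is a `C¹`-small radius: it is bounded by `ε` together with its gradient, and
`ε` is small compared with the scale `ρ`. -/
structure IsSmallRadius (F : Sph n → ℝ) (r K : ℝ) (u : Amb n → ℝ) (ε ρ : ℝ) : Prop where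
  smooth : SmoothOnSet u (shape F)
  abs_le : ∀ x ∈ shape F, |u x| ≤ ε
  grad_le : ∀ x ∈ shape F, ‖tangentialGradient F u x‖ ≤ ε
  eps_nonneg : 0 ≤ ε
  rho_pos : 0 < ρ
  rho_le : ρ ≤ r
  eps_le : ε ≤ ρ / 8
  mul_le : K * (ρ + ε) ≤ 1 / 4

theorem levelFun_sub_le (hF : IsEllipticIntegrand F) (ha : IsConvexityConst F a)
    (hr : IsTubeConst F a r K) (hu : IsSmallRadius F r K u ε ρ) {ξ z w : Amb n} (hξ : ‖ξ‖ = 1)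
    (hz : z ∈ Metric.ball (wulffMap F ξ) ρ) (hw : w ∈ Metric.ball (wulffMap F ξ) ρ) :
    |levelFun F a u z - levelFun F a u w - ⟪ξ, z - w⟫| ≤ K * (ρ + ε) * ‖z - w‖ := by
  have h := (convex_ball (wulffMap F ξ) ρ).norm_image_sub_le_of_norm_hasFDerivWithin_le'
    (f := levelFun F a u) (f' := fderiv ℝ (levelFun F a u)) (φ := innerSL ℝ ξ)
    (C := K * (ρ + ε)) (fun x hx => ?_) (fun x hx => ?_) hw hz
  · simpa using h
  · have hxt : x ∈ tube F a := hr.ball_subset ξ hξ (Metric.ball_subset_ball hu.rho_le hx)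
    exact (hasFDerivAt_levelFun hF ha hu.smooth hxt).differentiableAt.hasFDerivAt.hasFDerivWithinAt
  · rw [Metric.mem_ball, dist_eq_norm] at hx
    refine (hr.norm_fderiv_levelFun_sub_le u ε hu.smooth hu.grad_le ξ x hξ
      (hx.trans_le hu.rho_le)).trans ?_
    have := hr.K_pos
    gcongr

theorem mem_ball_wulffMap (hρ : 0 < ρ) {ξ c : Amb n} (hξ : ‖ξ‖ = 1) {t : ℝ} (ht : |t| ≤ ρ / 2)
    (hc : ‖c‖ ≤ ρ / 8) : wulffMap F ξ + t • ξ + c ∈ Metric.ball (wulffMap F ξ) ρ := by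
  rw [Metric.mem_ball, dist_eq_norm, show wulffMap F ξ + t • ξ + c - wulffMap F ξ = t • ξ + c by
    abel]
  have := norm_add_le (t • ξ) c
  rw [norm_smul, hξ, mul_one, Real.norm_eq_abs] at this
  linarith

theorem levelFun_translate_sub_le (hF : IsEllipticIntegrand F) (ha : IsConvexityConst F a)
    (hr : IsTubeConst F a r K) (hu : IsSmallRadius F r K u ε ρ) {ξ c d : Amb n} (hξ : ‖ξ‖ = 1)
    {s t : ℝ} (hs : |s| ≤ ρ / 2) (ht : |t| ≤ ρ / 2) (hc : ‖c‖ ≤ ρ / 8) (hd : ‖d‖ ≤ ρ / 8) :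
    |levelFun F a u (wulffMap F ξ + s • ξ + c) - levelFun F a u (wulffMap F ξ + t • ξ + d) -
      (s - t + ⟪ξ, c - d⟫)| ≤ K * (ρ + ε) * (|s - t| + ‖c - d‖) := by
  have h := levelFun_sub_le hF ha hr hu hξ (mem_ball_wulffMap (F := F) hu.rho_pos hξ hs hc)
    (mem_ball_wulffMap (F := F) hu.rho_pos hξ ht hd)
  have e : wulffMap F ξ + s • ξ + c - (wulffMap F ξ + t • ξ + d) = (s - t) • ξ + (c - d) := by
    module
  rw [e, inner_add_right, real_inner_smul_right, real_inner_self_eq_norm_sq, hξ, one_pow,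
    mul_one] at h
  refine h.trans ?_
  have h0 : 0 ≤ K * (ρ + ε) :=
    mul_nonneg hr.K_pos.le (add_nonneg hu.rho_pos.le hu.eps_nonneg)
  refine mul_le_mul_of_nonneg_left ?_ h0
  refine (norm_add_le _ _).trans ?_
  rw [norm_smul, hξ, mul_one, Real.norm_eq_abs]

theorem levelFun_wulffMap (hF : IsEllipticIntegrand F) (ha : IsConvexityConst F a)
    {ξ : Amb n} (hξ : ‖ξ‖ = 1) : levelFun F a u (wulffMap F ξ) = -u (wulffMap F ξ) := by
  rw [levelFun, tubeInv_wulffMap hF ha hξ, hξ]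
  ring

/-! ### Roots along the normals and the radius of a translate -/

/-- Comparison with `t = 0`, `c = 0`, where the value is `-u`, gives `|t| ≤ ε + |c| + (|t| +
|c|)/4`. -/
theorem abs_root_le (hF : IsEllipticIntegrand F) (ha : IsConvexityConst F a)
    (hr : IsTubeConst F a r K) (hu : IsSmallRadius F r K u ε ρ) {ξ c : Amb n} (hξ : ‖ξ‖ = 1)
    {t : ℝ} (ht : |t| ≤ ρ / 2) (hc : ‖c‖ ≤ ρ / 8)
    (h0 : levelFun F a u (wulffMap F ξ + t • ξ + c) = 0) :
    |t| ≤ 4 / 3 * ε + 5 / 3 * ‖c‖ := by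
  have hξ0 : ξ ≠ 0 := norm_ne_zero_iff.1 (by rw [hξ]; exact one_ne_zero)
  have hρ := hu.rho_pos
  have h := levelFun_translate_sub_le hF ha hr hu hξ ht (t := 0) (by simp; positivity) hc
    (d := 0) (by simp; positivity)
  simp only [zero_smul, add_zero, sub_zero, h0, levelFun_wulffMap hF ha hξ] at h
  have h1 := abs_real_inner_le_norm ξ c
  rw [hξ, one_mul] at h1
  have h2 := hu.abs_le _ (wulffMap_mem_shape hF hξ0)
  have h3 : K * (ρ + ε) * (|t| + ‖c‖) ≤ 1 / 4 * (|t| + ‖c‖) := by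
    gcongr
    exact hu.mul_le
  have h4 := h.trans h3
  rw [abs_le] at h1 h2 h4
  rcases abs_cases t with ⟨h5, -⟩ | ⟨h5, -⟩ <;> rw [h5] at h4 ⊢ <;> linarith

/-- The central first-order expansion: translating by `c` moves the root by `-⟨ξ, c⟩`. Absorbing a
quarter of `|s - t|` gives `|s - t| ≤ 2|c - d|`, hence the factor `3`. -/
theorem root_sub_le (hF : IsEllipticIntegrand F) (ha : IsConvexityConst F a)
    (hr : IsTubeConst F a r K) (hu : IsSmallRadius F r K u ε ρ) {ξ c d : Amb n} (hξ : ‖ξ‖ = 1)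
    {s t : ℝ} (hs : |s| ≤ ρ / 2) (ht : |t| ≤ ρ / 2) (hc : ‖c‖ ≤ ρ / 8) (hd : ‖d‖ ≤ ρ / 8)
    (hs0 : levelFun F a u (wulffMap F ξ + s • ξ + c) = 0)
    (ht0 : levelFun F a u (wulffMap F ξ + t • ξ + d) = 0) :
    |s - t + ⟪ξ, c - d⟫| ≤ 3 * (K * (ρ + ε)) * ‖c - d‖ := by
  have h := levelFun_translate_sub_le hF ha hr hu hξ hs ht hc hd
  rw [hs0, ht0, sub_zero, zero_sub, abs_neg] at h
  have h0 : 0 ≤ K * (ρ + ε) :=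
    mul_nonneg hr.K_pos.le (add_nonneg hu.rho_pos.le hu.eps_nonneg)
  have h1 := abs_real_inner_le_norm ξ (c - d)
  rw [hξ, one_mul] at h1
  have h2 : |s - t| ≤ |s - t + ⟪ξ, c - d⟫| + |⟪ξ, c - d⟫| := by
    have := abs_sub (s - t + ⟪ξ, c - d⟫) ⟪ξ, c - d⟫
    simpa using this
  have h3 : K * (ρ + ε) * (|s - t| + ‖c - d‖) ≤ 1 / 4 * (|s - t| + ‖c - d‖) := by
    gcongr
    exact hu.mul_le
  have h4 : |s - t| ≤ 2 * ‖c - d‖ := by linarith [norm_nonneg (c - d)]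
  refine h.trans ?_
  calc K * (ρ + ε) * (|s - t| + ‖c - d‖) ≤ K * (ρ + ε) * (2 * ‖c - d‖ + ‖c - d‖) := by gcongr
    _ = _ := by ring

theorem root_unique (hF : IsEllipticIntegrand F) (ha : IsConvexityConst F a)
    (hr : IsTubeConst F a r K) (hu : IsSmallRadius F r K u ε ρ) {ξ c : Amb n} (hξ : ‖ξ‖ = 1)
    {s t : ℝ} (hs : |s| ≤ ρ / 2) (ht : |t| ≤ ρ / 2) (hc : ‖c‖ ≤ ρ / 8)
    (hs0 : levelFun F a u (wulffMap F ξ + s • ξ + c) = 0)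
    (ht0 : levelFun F a u (wulffMap F ξ + t • ξ + c) = 0) : s = t := by
  have h := root_sub_le hF ha hr hu hξ hs ht hc hc hs0 ht0
  simp only [sub_self, inner_zero_right, add_zero, norm_zero, mul_zero] at h
  exact sub_eq_zero.1 (abs_nonpos_iff.1 h)

/-- At `t = ±ρ/2` the deviation of the value from `t` is at most `ρ/8 + ρ/8 + (ρ/2 + ρ/8)/4 < ρ/2`,
so the sign changes. -/
theorem exists_root (hF : IsEllipticIntegrand F) (ha : IsConvexityConst F a)
    (hr : IsTubeConst F a r K) (hu : IsSmallRadius F r K u ε ρ) {ξ c : Amb n} (hξ : ‖ξ‖ = 1)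
    (hc : ‖c‖ ≤ ρ / 8) :
    ∃ t, |t| ≤ ρ / 2 ∧ levelFun F a u (wulffMap F ξ + t • ξ + c) = 0 := by
  have hξ0 : ξ ≠ 0 := norm_ne_zero_iff.1 (by rw [hξ]; exact one_ne_zero)
  have hρ := hu.rho_pos
  have key : ∀ t : ℝ, |t| ≤ ρ / 2 →
      |levelFun F a u (wulffMap F ξ + t • ξ + c) + u (wulffMap F ξ) - (t + ⟪ξ, c⟫)| ≤
        1 / 4 * (|t| + ‖c‖) := by
    intro t ht
    have h := levelFun_translate_sub_le hF ha hr hu hξ ht (t := 0) (by simp; positivity) hc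
      (d := 0) (by simp; positivity)
    simp only [zero_smul, add_zero, sub_zero, levelFun_wulffMap hF ha hξ, sub_neg_eq_add] at h
    refine h.trans ?_
    gcongr
    exact hu.mul_le
  have h1 := abs_real_inner_le_norm ξ c
  rw [hξ, one_mul] at h1
  have h2 := hu.abs_le _ (wulffMap_mem_shape hF hξ0)
  have hε := hu.eps_le
  rw [abs_le] at h1 h2
  have hcont : ContinuousOn (fun t : ℝ => levelFun F a u (wulffMap F ξ + t • ξ + c))
      (Set.Icc (-(ρ / 2)) (ρ / 2)) := by
    intro t ht
    have hm := mem_ball_wulffMap (F := F) hρ hξ (abs_le.2 ht) hc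
    have hmt := hr.ball_subset ξ hξ (Metric.ball_subset_ball hu.rho_le hm)
    refine ContinuousAt.continuousWithinAt ?_
    exact ContinuousAt.comp (f := fun t : ℝ => wulffMap F ξ + t • ξ + c)
      (contDiffAt_levelFun hF ha hu.smooth hmt).continuousAt (by fun_prop)
  have hpos := key (ρ / 2) (by rw [abs_of_pos (by positivity)])
  have hneg := key (-(ρ / 2)) (by rw [abs_neg, abs_of_pos (by positivity)])
  rw [abs_of_pos (by positivity : 0 < ρ / 2), abs_le] at hpos
  rw [abs_neg, abs_of_pos (by positivity : 0 < ρ / 2), abs_le] at hneg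
  obtain ⟨t, ht, ht0⟩ := intermediate_value_Icc (by linarith : -(ρ / 2) ≤ ρ / 2) hcont
    (show (0 : ℝ) ∈ _ from ⟨by linarith, by linarith⟩)
  exact ⟨t, abs_le.2 ht, ht0⟩

/-- The radius of the translate by `-c` of the radial graph of `u`. -/
def shiftedRadius (F : Sph n → ℝ) (a : ℝ) (u : Amb n → ℝ) (ρ : ℝ) (c x : Amb n) : ℝ :=
  Classical.epsilon fun t : ℝ => |t| ≤ ρ / 2 ∧ levelFun F a u (x + t • normal F x + c) = 0

theorem shiftedRadius_spec (hF : IsEllipticIntegrand F) (ha : IsConvexityConst F a)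
    (hr : IsTubeConst F a r K) (hu : IsSmallRadius F r K u ε ρ) {ξ c : Amb n} (hξ : ‖ξ‖ = 1)
    (hc : ‖c‖ ≤ ρ / 8) : |shiftedRadius F a u ρ c (wulffMap F ξ)| ≤ ρ / 2 ∧
      levelFun F a u (wulffMap F ξ + shiftedRadius F a u ρ c (wulffMap F ξ) • ξ + c) = 0 := by
  have h := Classical.epsilon_spec (p := fun t : ℝ => |t| ≤ ρ / 2 ∧
    levelFun F a u (wulffMap F ξ + t • normal F (wulffMap F ξ) + c) = 0) (by
      rw [normal_wulffMap hF hξ]; exact exists_root hF ha hr hu hξ hc)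
  change |shiftedRadius F a u ρ c (wulffMap F ξ)| ≤ ρ / 2 ∧ levelFun F a u (wulffMap F ξ +
    shiftedRadius F a u ρ c (wulffMap F ξ) • normal F (wulffMap F ξ) + c) = 0 at h
  rwa [normal_wulffMap hF hξ] at h

theorem abs_shiftedRadius_le (hF : IsEllipticIntegrand F) (ha : IsConvexityConst F a)
    (hr : IsTubeConst F a r K) (hu : IsSmallRadius F r K u ε ρ) {x c : Amb n} (hx : x ∈ shape F)
    (hc : ‖c‖ ≤ ρ / 8) : |shiftedRadius F a u ρ c x| ≤ 4 / 3 * ε + 5 / 3 * ‖c‖ := by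
  obtain ⟨ξ, hξ, -, rfl⟩ := exists_eq_wulffMap hF hx
  have h := shiftedRadius_spec hF ha hr hu hξ hc
  exact abs_root_le hF ha hr hu hξ h.1 hc h.2

theorem fderiv_levelFun_normal (hr : IsTubeConst F a r K) (hu : IsSmallRadius F r K u ε ρ)
    {ξ z : Amb n} (hξ : ‖ξ‖ = 1) (hz : z ∈ Metric.ball (wulffMap F ξ) ρ) :
    3 / 4 ≤ fderiv ℝ (levelFun F a u) z ξ := by
  rw [Metric.mem_ball, dist_eq_norm] at hz
  have h1 := hr.norm_fderiv_levelFun_sub_le u ε hu.smooth hu.grad_le ξ z hξ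
    (hz.trans_le hu.rho_le)
  have h2 := (fderiv ℝ (levelFun F a u) z - innerSL ℝ ξ).le_opNorm ξ
  have h3 : K * (‖z - wulffMap F ξ‖ + ε) ≤ K * (ρ + ε) := by
    have := hr.K_pos
    gcongr
  have h4 := h2.trans (by rw [hξ, mul_one])
  simp only [sub_apply, innerSL_apply_apply, real_inner_self_eq_norm_sq, hξ,
    one_pow, Real.norm_eq_abs] at h4
  linarith [(abs_le.1 h4).1, hu.mul_le]

/-- The derivative in `t` is at least `3/4`, so the implicit function theorem gives a smooth local
solution, which uniqueness of small roots identifies with the radius. -/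
theorem contDiffAt_shiftedRadius (hF : IsEllipticIntegrand F) (ha : IsConvexityConst F a)
    (hr : IsTubeConst F a r K) (hu : IsSmallRadius F r K u ε ρ) {c : Amb n} (hc : ‖c‖ ≤ ρ / 8)
    {y : Amb n} (hy : y ≠ 0) :
    ContDiffAt ℝ ∞ (fun z => shiftedRadius F a u ρ c (wulffMap F z)) y := by
  have hnorm : ∀ {z : Amb n}, z ≠ 0 → ‖‖z‖⁻¹ • z‖ = 1 := fun hz => by simp [norm_smul, hz]
  have hX : ∀ {z : Amb n}, z ≠ 0 → wulffMap F (‖z‖⁻¹ • z) = wulffMap F z := fun hz =>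
    wulffMap_smul hF (inv_pos.2 (norm_pos_iff.2 hz)) hz
  have hspec : ∀ {z : Amb n}, z ≠ 0 → |shiftedRadius F a u ρ c (wulffMap F z)| ≤ ρ / 2 ∧
      levelFun F a u (wulffMap F z + shiftedRadius F a u ρ c (wulffMap F z) • ‖z‖⁻¹ • z + c) =
        0 := fun hz => by
    have := shiftedRadius_spec hF ha hr hu (hnorm hz) hc
    rwa [hX hz] at this
  set t₀ := shiftedRadius F a u ρ c (wulffMap F y) with ht₀
  let q : Amb n × ℝ → Amb n := fun p => wulffMap F p.1 + p.2 • ‖p.1‖⁻¹ • p.1 + c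
  have hball : q (y, t₀) ∈ Metric.ball (wulffMap F (‖y‖⁻¹ • y)) ρ := by
    have := mem_ball_wulffMap (F := F) hu.rho_pos (hnorm hy) (hspec hy).1 hc
    rwa [hX hy] at this ⊢
  have htube : q (y, t₀) ∈ tube F a :=
    hr.ball_subset _ (hnorm hy) (Metric.ball_subset_ball hu.rho_le hball)
  have hq : ContDiffAt ℝ ∞ q (y, t₀) := by
    have h1 : ContDiffAt ℝ ∞ (fun p : Amb n × ℝ => wulffMap F p.1) (y, t₀) :=
      (contDiffAt_wulffMap hF hy).comp (y, t₀) contDiffAt_fst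
    have h2 : ContDiffAt ℝ ∞ (fun p : Amb n × ℝ => ‖p.1‖⁻¹ • p.1) (y, t₀) :=
      ContDiffAt.comp (g := fun z : Amb n => ‖z‖⁻¹ • z) (f := Prod.fst) (y, t₀)
        (contDiffAt_normalize hy) contDiffAt_fst
    exact (h1.add (contDiffAt_snd.smul h2)).add contDiffAt_const
  have hG := contDiffAt_levelFun hF ha hu.smooth htube
  have hf : ContDiffAt ℝ ∞ (fun p => levelFun F a u (q p)) (y, t₀) := hG.comp (y, t₀) hq
  have hder : ∀ τ : ℝ, fderiv ℝ (fun p => levelFun F a u (q p)) (y, t₀) (0, τ) =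
      τ * fderiv ℝ (levelFun F a u) (q (y, t₀)) (‖y‖⁻¹ • y) := by
    intro τ
    have hline : HasDerivAt (fun s : ℝ => q (y, t₀ + s * τ)) (τ • ‖y‖⁻¹ • y) 0 := by
      have h1 : HasDerivAt (fun s : ℝ => t₀ + s * τ) τ 0 := by
        simpa using ((hasDerivAt_id (0 : ℝ)).mul_const τ).const_add t₀
      exact ((h1.smul_const (‖y‖⁻¹ • y)).const_add (wulffMap F y)).add_const c
    have hline2 : HasDerivAt (fun s : ℝ => ((y, t₀ + s * τ) : Amb n × ℝ)) (0, τ) 0 := by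
      have h1 : HasDerivAt (fun s : ℝ => t₀ + s * τ) τ 0 := by
        simpa using ((hasDerivAt_id (0 : ℝ)).mul_const τ).const_add t₀
      exact (hasDerivAt_const (0 : ℝ) y).prodMk h1
    have d1 := (hG.differentiableAt (by simp)).hasFDerivAt.comp_hasDerivAt_of_eq (0 : ℝ) hline
      (by simp)
    have d2 := (hf.differentiableAt (by simp)).hasFDerivAt.comp_hasDerivAt_of_eq (0 : ℝ) hline2
      (by simp)
    have := d2.unique d1
    simpa using this
  have hpos : 0 < fderiv ℝ (levelFun F a u) (q (y, t₀)) (‖y‖⁻¹ • y) :=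
    lt_of_lt_of_le (by norm_num) (fderiv_levelFun_normal hr hu (hnorm hy) hball)
  have hinv : (fderiv ℝ (fun p => levelFun F a u (q p)) (y, t₀) ∘L
      .inr ℝ (Amb n) ℝ).IsInvertible := by
    refine ⟨ContinuousLinearEquiv.unitsEquivAut ℝ (Units.mk0 _ hpos.ne'), ?_⟩
    ext
    simp [hder]
  have htop : (∞ : WithTop ℕ∞) ≠ 0 := by simp
  set ψ := hf.implicitFunction htop hinv with hψ
  have hψc : ContDiffAt ℝ ∞ ψ y := hf.contDiffAt_implicitFunction htop hinv
  have hψ0 : ψ y = t₀ := hf.implicitFunction_apply_self htop hinv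
  have hψe : ∀ᶠ z in nhds y, levelFun F a u (q (z, ψ z)) = levelFun F a u (q (y, t₀)) :=
    hf.eventually_apply_implicitFunction htop hinv
  -- The a priori bound gives at most `3ρ/8`; the strict inequality keeps nearby implicit solutions
  -- in the range where roots are unique.
  have hlt : |ψ y| < ρ / 2 := by
    rw [hψ0]
    have := abs_shiftedRadius_le hF ha hr hu (wulffMap_mem_shape hF hy) hc
    linarith [hu.eps_le, hu.rho_pos]
  refine hψc.congr_of_eventuallyEq ?_
  filter_upwards [hψe, hψc.continuousAt.abs.eventually (gt_mem_nhds hlt), isOpen_ne.mem_nhds hy]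
    with z h1 h2 h3
  have h4 := hspec h3
  rw [show levelFun F a u (q (y, t₀)) = 0 from (hspec hy).2] at h1
  have h5 : wulffMap F (‖z‖⁻¹ • z) = wulffMap F z := hX h3
  refine root_unique hF ha hr hu (hnorm h3) h4.1 h2.le hc ?_ ?_
  · rw [h5]; exact h4.2
  · rw [h5]; exact h1

theorem smoothOnSet_shiftedRadius (hF : IsEllipticIntegrand F) (ha : IsConvexityConst F a)
    (hr : IsTubeConst F a r K) (hu : IsSmallRadius F r K u ε ρ) {c : Amb n}
    (hc : ‖c‖ ≤ ρ / 8) : SmoothOnSet (shiftedRadius F a u ρ c) (shape F) :=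
  smoothOnSet_of_comp_wulffMap hF fun _ hy => contDiffAt_shiftedRadius hF ha hr hu hc hy

/-- Differentiating `G(X + tν + c) = 0` along `v` gives `D p + (T v) D ξ = 0` with `p ⊥ ξ`. Since
`D` is close to `⟨ξ, ·⟩`, `D p` is small, while `D ξ ≥ 3/4`. The constant `4` is `3` from `|t| + |c|
+ ε ≤ 3(ε + |c|)`, divided by `3/4`. -/
theorem norm_fderiv_shiftedRadius_le (hF : IsEllipticIntegrand F) (ha : IsConvexityConst F a)
    (hr : IsTubeConst F a r K) (hu : IsSmallRadius F r K u ε ρ) {c : Amb n} (hc : ‖c‖ ≤ ρ / 8)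
    {ξ : Amb n} (hξ : ‖ξ‖ = 1) :
    ‖fderiv ℝ (fun z => shiftedRadius F a u ρ c (wulffMap F z)) ξ‖ ≤
      4 * K * (K + a) * (ε + ‖c‖) := by
  have hξ0 : ξ ≠ 0 := norm_ne_zero_iff.1 (by rw [hξ]; exact one_ne_zero)
  have hKp := hr.K_pos
  have hap := ha.pos
  have hε0 := hu.eps_nonneg
  set T := fderiv ℝ (fun z => shiftedRadius F a u ρ c (wulffMap F z)) ξ with hT
  set t := shiftedRadius F a u ρ c (wulffMap F ξ) with ht
  have hspec := shiftedRadius_spec hF ha hr hu hξ hc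
  rw [← ht] at hspec
  have habs := abs_shiftedRadius_le hF ha hr hu (wulffMap_mem_shape hF hξ0) hc
  rw [← ht] at habs
  set z := wulffMap F ξ + t • ξ + c with hz
  have hball : z ∈ Metric.ball (wulffMap F ξ) ρ := mem_ball_wulffMap hu.rho_pos hξ hspec.1 hc
  have htube : z ∈ tube F a := hr.ball_subset ξ hξ (Metric.ball_subset_ball hu.rho_le hball)
  set N : Amb n →L[ℝ] Amb n := ‖ξ‖⁻¹ • ContinuousLinearMap.id ℝ (Amb n) -
    (‖ξ‖⁻¹ ^ 3) • (innerSL ℝ ξ).smulRight ξ with hN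
  have hNv : ∀ v, N v = v - ⟪ξ, v⟫ • ξ := fun v => by simp [hN, hξ]
  have hTd : HasFDerivAt (fun z => shiftedRadius F a u ρ c (wulffMap F z)) T ξ :=
    ((contDiffAt_shiftedRadius hF ha hr hu hc hξ0).differentiableAt (by simp)).hasFDerivAt
  have hq : HasFDerivAt (fun y => wulffMap F y +
      shiftedRadius F a u ρ c (wulffMap F y) • ‖y‖⁻¹ • y + c)
      (fderiv ℝ (wulffMap F) ξ + (t • N + T.smulRight (‖ξ‖⁻¹ • ξ))) ξ :=
    ((hasFDerivAt_wulffMap hF hξ0).add (hTd.smul (hasFDerivAt_normalize hξ0))).add_const c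
  have hG : HasFDerivAt (levelFun F a u) (fderiv ℝ (levelFun F a u) z) z :=
    (hasFDerivAt_levelFun hF ha hu.smooth htube).differentiableAt.hasFDerivAt
  have hz' : wulffMap F ξ + shiftedRadius F a u ρ c (wulffMap F ξ) • ‖ξ‖⁻¹ • ξ + c = z := by
    simp [hξ, hz, ht]
  rw [← hz'] at hG
  have hcomp := hG.comp ξ hq
  rw [hz'] at hcomp
  have hzero : HasFDerivAt (levelFun F a u ∘ fun y => wulffMap F y +
      shiftedRadius F a u ρ c (wulffMap F y) • ‖y‖⁻¹ • y + c) (0 : Amb n →L[ℝ] ℝ) ξ := by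
    refine (hasFDerivAt_const (0 : ℝ) ξ).congr_of_eventuallyEq ?_
    filter_upwards [isOpen_ne.mem_nhds hξ0] with y hy
    have h := (shiftedRadius_spec hF ha hr hu (ξ := ‖y‖⁻¹ • y) (by simp [norm_smul, hy]) hc).2
    rwa [wulffMap_smul hF (inv_pos.2 (norm_pos_iff.2 hy)) hy] at h
  have heq := hcomp.unique hzero
  set D := fderiv ℝ (levelFun F a u) z with hD
  have hDn : ‖D - innerSL ℝ ξ‖ ≤ K * (|t| + ‖c‖ + ε) := by
    rw [Metric.mem_ball, dist_eq_norm] at hball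
    refine (hr.norm_fderiv_levelFun_sub_le u ε hu.smooth hu.grad_le ξ z hξ
      (hball.trans_le hu.rho_le)).trans ?_
    gcongr
    rw [hz, show wulffMap F ξ + t • ξ + c - wulffMap F ξ = t • ξ + c by abel]
    refine (norm_add_le _ _).trans ?_
    rw [norm_smul, hξ, mul_one, Real.norm_eq_abs]
  have hDξ := fderiv_levelFun_normal hr hu hξ hball
  refine ContinuousLinearMap.opNorm_le_bound _ (by positivity) fun v => ?_
  set p := fderiv ℝ (wulffMap F) ξ v + t • N v with hp
  have h1 : D p + T v * D ξ = 0 := by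
    have := congrArg (fun L => L v) heq
    simp [hξ] at this
    rw [hp, map_add, map_smul, smul_eq_mul]
    linarith
  have h2 : ⟪ξ, p⟫ = 0 := by
    rw [hp, inner_add_right, real_inner_comm, inner_fderiv_wulffMap hF hξ0, real_inner_smul_right,
      hNv, inner_sub_right, real_inner_smul_right, real_inner_self_eq_norm_sq, hξ]
    ring
  have h3 : ‖p‖ ≤ (K + a) * ‖v‖ := by
    have e1 : ‖fderiv ℝ (wulffMap F) ξ v‖ ≤ K * ‖v‖ :=
      ((fderiv ℝ (wulffMap F) ξ).le_opNorm v).trans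
        (mul_le_mul_of_nonneg_right (hr.norm_fderiv_wulffMap_le ξ hξ) (norm_nonneg _))
    have e2 : ‖N v‖ ≤ 2 * ‖v‖ := by
      rw [hNv]
      refine (norm_sub_le _ _).trans ?_
      rw [norm_smul, hξ, mul_one]
      have := abs_real_inner_le_norm ξ v
      rw [hξ, one_mul] at this
      rw [Real.norm_eq_abs]
      linarith
    have e3 : |t| ≤ a / 2 := by linarith [hspec.1, hu.rho_le, hr.r_le]
    refine (norm_add_le _ _).trans ?_
    rw [norm_smul, Real.norm_eq_abs, add_mul]
    refine add_le_add e1 ?_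
    calc |t| * ‖N v‖ ≤ a / 2 * (2 * ‖v‖) := by gcongr
      _ = a * ‖v‖ := by ring
  have h4 : |D p| ≤ K * (|t| + ‖c‖ + ε) * ((K + a) * ‖v‖) := by
    have e := (D - innerSL ℝ ξ).le_opNorm p
    rw [sub_apply, innerSL_apply_apply, h2, sub_zero, Real.norm_eq_abs] at e
    exact e.trans (by gcongr)
  have h5 : |T v| * (3 / 4) ≤ |D p| := by
    have e : D p = -(T v * D ξ) := by linarith
    rw [e, abs_neg, abs_mul]
    gcongr
    exact hDξ.trans (le_abs_self _)
  rw [Real.norm_eq_abs]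
  have h6 : K * (|t| + ‖c‖ + ε) * ((K + a) * ‖v‖) ≤
      K * (3 * (ε + ‖c‖)) * ((K + a) * ‖v‖) := by
    gcongr
    linarith [norm_nonneg c]
  linarith

theorem C1norm_shiftedRadius_le (hF : IsEllipticIntegrand F) (ha : IsConvexityConst F a)
    (hr : IsTubeConst F a r K) (hu : IsSmallRadius F r K u ε ρ) {c : Amb n} (hc : ‖c‖ ≤ ρ / 8) :
    C1norm F (shiftedRadius F a u ρ c) ≤ (2 + 4 * K * (K + a) / a) * (ε + ‖c‖) := by
  have hap := ha.pos
  have hKp := hr.K_pos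
  have hε0 := hu.eps_nonneg
  rw [add_mul]
  refine C1norm_le (by positivity) (by positivity) (fun x hx => ?_) (fun x hx => ?_)
  · have := abs_shiftedRadius_le hF ha hr hu hx hc
    linarith [norm_nonneg c]
  · obtain ⟨ξ, hξ, -, rfl⟩ := exists_eq_wulffMap hF hx
    have h := (norm_tangentialGradient_le hF ha (smoothOnSet_shiftedRadius hF ha hr hu hc)
      hξ).trans (norm_fderiv_shiftedRadius_le hF ha hr hu hc hξ)
    rw [div_mul_eq_mul_div, le_div_iff₀ hap, mul_comm]
    exact h

/-! ### The translate is a radial graph -/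

theorem eq_of_mem_tube (hF : IsEllipticIntegrand F) {z : Amb n} (hz : z ∈ tube F a) :
    ∃ ξ : Amb n, ‖ξ‖ = 1 ∧ wulffMap F (tubeInv F a z) = wulffMap F ξ ∧
      z = wulffMap F ξ + (a * (‖tubeInv F a z‖ - 1)) • ξ := by
  set y := tubeInv F a z with hy
  have hy0 : y ≠ 0 := tubeInv_ne_zero hz
  have hp := norm_pos_iff.2 hy0
  have hξ : ‖‖y‖⁻¹ • y‖ = 1 := by simp [norm_smul, hy0]
  refine ⟨‖y‖⁻¹ • y, hξ, (wulffMap_smul hF (inv_pos.2 hp) hy0).symm, ?_⟩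
  rw [← tubeMap_smul hF a hp hξ, smul_smul, mul_inv_cancel₀ hp.ne', one_smul, hy,
    tubeMap_tubeInv hz]

theorem levelFun_graph (hF : IsEllipticIntegrand F) (ha : IsConvexityConst F a) {ξ : Amb n}
    (hξ : ‖ξ‖ = 1) (h : |u (wulffMap F ξ)| < a) :
    levelFun F a u (wulffMap F ξ + u (wulffMap F ξ) • ξ) = 0 := by
  have hξ0 : ξ ≠ 0 := norm_ne_zero_iff.1 (by rw [hξ]; exact one_ne_zero)
  have hap := ha.pos
  have h1 := (abs_lt.1 h).1
  have hpos : 0 < 1 + u (wulffMap F ξ) / a := by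
    rw [show 1 + u (wulffMap F ξ) / a = (a + u (wulffMap F ξ)) / a by field_simp]
    exact div_pos (by linarith) hap
  rw [levelFun, (normal_coordinates hF ha hξ h1).2, wulffMap_smul hF hpos hξ0, norm_smul, hξ,
    Real.norm_of_nonneg hpos.le]
  field_simp
  ring

/-- The inverse diffeomorphism is the foot point map `X ∘ tubeInv`, smooth on the whole tube. A zero
of `G` in the tube is a point of `S`, which gives the inclusion; for surjectivity, the height of a
point of `S - c` is a small root, and roots are unique. -/
theorem isRadialGraph_shiftedRadius (hF : IsEllipticIntegrand F) (ha : IsConvexityConst F a)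
    (hr : IsTubeConst F a r K) (hu : IsSmallRadius F r K u ε ρ) {c : Amb n} (hc : ‖c‖ ≤ ρ / 8)
    {S : Set (Amb n)} (hS : IsRadialGraph F S u) :
    IsRadialGraph F ((fun y => y - c) '' S) (shiftedRadius F a u ρ c) := by
  have hρa : ρ ≤ a / 2 := hu.rho_le.trans hr.r_le
  have hρ := hu.rho_pos
  have hap := ha.pos
  have huc := smoothOnSet_shiftedRadius hF ha hr hu hc
  have hshift : ∀ {ξ : Amb n}, ‖ξ‖ = 1 → -a < shiftedRadius F a u ρ c (wulffMap F ξ) := by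
    intro ξ hξ
    linarith [(abs_le.1 (shiftedRadius_spec hF ha hr hu hξ hc).1).1]
  have hgraph : ∀ {ξ : Amb n}, ‖ξ‖ = 1 →
      wulffMap F ξ + shiftedRadius F a u ρ c (wulffMap F ξ) • normal F (wulffMap F ξ) ∈ tube F a ∧
      wulffMap F (tubeInv F a (wulffMap F ξ +
        shiftedRadius F a u ρ c (wulffMap F ξ) • normal F (wulffMap F ξ))) = wulffMap F ξ := by
    intro ξ hξ
    have hξ0 : ξ ≠ 0 := norm_ne_zero_iff.1 (by rw [hξ]; exact one_ne_zero)
    have h := normal_coordinates hF ha hξ (hshift hξ)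
    rw [normal_wulffMap hF hξ]
    refine ⟨h.1, ?_⟩
    rw [h.2]
    refine wulffMap_smul hF ?_ hξ0
    have := hshift hξ
    rw [show 1 + shiftedRadius F a u ρ c (wulffMap F ξ) / a =
      (a + shiftedRadius F a u ρ c (wulffMap F ξ)) / a by field_simp]
    exact div_pos (by linarith) hap
  have hmaps : Set.MapsTo (fun x => x + shiftedRadius F a u ρ c x • normal F x) (shape F)
      ((fun y => y - c) '' S) := by
    intro x hx
    obtain ⟨ξ, hξ, -, rfl⟩ := exists_eq_wulffMap hF hx
    have hspec := shiftedRadius_spec hF ha hr hu hξ hc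
    have hb := mem_ball_wulffMap (F := F) hρ hξ hspec.1 hc
    have ht := hr.ball_subset ξ hξ (Metric.ball_subset_ball hu.rho_le hb)
    obtain ⟨η, hη, hη1, hη2⟩ := eq_of_mem_tube hF ht
    have h0 := hspec.2
    rw [levelFun, sub_eq_zero, hη1] at h0
    rw [h0] at hη2
    have hη0 : η ≠ 0 := norm_ne_zero_iff.1 (by rw [hη]; exact one_ne_zero)
    refine ⟨_, hS.2.2.1.mapsTo (wulffMap_mem_shape hF hη0), ?_⟩
    simp only [normal_wulffMap hF hη, normal_wulffMap hF hξ]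
    rw [← hη2]
    abel
  have hsurj : Set.SurjOn (fun x => x + shiftedRadius F a u ρ c x • normal F x) (shape F)
      ((fun y => y - c) '' S) := by
    rintro _ ⟨z, hz, rfl⟩
    obtain ⟨x, hx, rfl⟩ := hS.2.2.1.surjOn hz
    obtain ⟨η, hη, hη0, rfl⟩ := exists_eq_wulffMap hF hx
    have huη := hu.abs_le _ hx
    simp only [normal_wulffMap hF hη]
    set z := wulffMap F η + u (wulffMap F η) • η with hzdef
    have hGz : levelFun F a u z = 0 :=
      levelFun_graph hF ha hη (by linarith [hu.eps_le])
    have hdist : ‖z - c - wulffMap F η‖ ≤ ρ / 4 := by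
      rw [hzdef, show wulffMap F η + u (wulffMap F η) • η - c - wulffMap F η =
        u (wulffMap F η) • η - c by abel]
      refine (norm_sub_le _ _).trans ?_
      rw [norm_smul, hη, mul_one, Real.norm_eq_abs]
      linarith [hu.eps_le]
    have ht : z - c ∈ tube F a := by
      refine hr.ball_subset η hη ?_
      rw [Metric.mem_ball, dist_eq_norm]
      linarith [hu.rho_le]
    obtain ⟨ξ, hξ, -, hξ2⟩ := eq_of_mem_tube hF ht
    have hξ0 : ξ ≠ 0 := norm_ne_zero_iff.1 (by rw [hξ]; exact one_ne_zero)
    set t := a * (‖tubeInv F a (z - c)‖ - 1) with htdef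
    -- The signed distance of `z - c` is at most its distance `ρ/4` from the point `X(η)` of the
    -- shape.
    have hta : |t| ≤ ρ / 2 := by
      have h1 := tubeInv_lipschitz hF ha ht (wulffMap_mem_tube hF a hη)
      rw [tubeInv_wulffMap hF ha hη] at h1
      have h2 := abs_norm_sub_norm_le (tubeInv F a (z - c)) η
      rw [hη] at h2
      rw [htdef, abs_mul, abs_of_pos hap]
      nlinarith
    have hspec := shiftedRadius_spec hF ha hr hu hξ hc
    have heq := root_unique hF ha hr hu hξ hspec.1 hta hc hspec.2 (by
      rw [← hξ2, sub_add_cancel]; exact hGz)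
    refine ⟨wulffMap F ξ, wulffMap_mem_shape hF hξ0, ?_⟩
    simp only [normal_wulffMap hF hξ]
    rw [heq, ← hξ2]
  have hleft : Set.LeftInvOn (fun z => wulffMap F (tubeInv F a z))
      (fun x => x + shiftedRadius F a u ρ c x • normal F x) (shape F) := by
    intro x hx
    obtain ⟨ξ, hξ, -, rfl⟩ := exists_eq_wulffMap hF hx
    exact (hgraph hξ).2
  refine ⟨huc, ?_, ⟨hmaps, hleft.injOn, hsurj⟩, fun z => wulffMap F (tubeInv F a z), ?_, hleft, ?_⟩
  · refine smoothOnSet_of_comp_wulffMap hF fun y hy => ?_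
    have h1 := contDiffAt_wulffMap hF hy
    have h2 := huc.contDiffAt_comp_wulffMap hF hy
    have h3 := (h1.add (h2.smul (contDiffAt_normalize hy)))
    refine h3.congr_of_eventuallyEq ?_
    filter_upwards [isOpen_ne.mem_nhds hy] with z hz
    have hn : normal F (wulffMap F z) = ‖z‖⁻¹ • z := by
      rw [← wulffMap_smul hF (inv_pos.2 (norm_pos_iff.2 hz)) hz]
      exact normal_wulffMap hF (by simp [norm_smul, hz])
    simp [hn]
  · intro z hz
    refine ⟨tube F a, fun z => wulffMap F (tubeInv F a z), isOpen_tube hF ha, ?_, fun w hw => ?_,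
      fun w _ => rfl⟩
    · obtain ⟨x, hx, rfl⟩ := hsurj hz
      obtain ⟨ξ, hξ, -, rfl⟩ := exists_eq_wulffMap hF hx
      exact (hgraph hξ).1
    · exact ((contDiffAt_wulffMap hF (tubeInv_ne_zero hw)).comp w
        (contDiffAt_tubeInv hF ha hw)).contDiffWithinAt
  · intro z hz
    obtain ⟨x, hx, rfl⟩ := hsurj hz
    exact congrArg (fun x => x + shiftedRadius F a u ρ c x • normal F x) (hleft hx)

/-! ### The moment map and its zero -/

/-- The vector of the moments `-∫ u_c ν` of the radius of the translate by `-c`. -/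
def radiusMoment (F : Sph n → ℝ) (a : ℝ) (u : Amb n → ℝ) (ρ : ℝ) (c : Amb n) : Amb n :=
  -∫ x, shiftedRadius F a u ρ c x • normal F x ∂(surfaceMeasure F)

theorem integrable_shiftedRadius_smul (hF : IsEllipticIntegrand F) (ha : IsConvexityConst F a)
    (hr : IsTubeConst F a r K) (hu : IsSmallRadius F r K u ε ρ) {c : Amb n} (hc : ‖c‖ ≤ ρ / 8) :
    Integrable (fun x => shiftedRadius F a u ρ c x • normal F x) (surfaceMeasure F) :=
  integrable_surfaceMeasure hF
    ((smoothOnSet_shiftedRadius hF ha hr hu hc).continuousOn.smul (continuousOn_normal hF))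

theorem ae_mem_shape (hF : IsEllipticIntegrand F) : ∀ᵐ x ∂(surfaceMeasure F), x ∈ shape F :=
  ae_restrict_mem (isCompact_shape hF).measurableSet

theorem norm_radiusMoment_zero_le (hF : IsEllipticIntegrand F) (ha : IsConvexityConst F a)
    (hr : IsTubeConst F a r K) (hu : IsSmallRadius F r K u ε ρ) :
    ‖radiusMoment F a u ρ 0‖ ≤ 4 / 3 * ε * (surfaceMeasure F).real Set.univ := by
  have hρ := hu.rho_pos
  have := isFiniteMeasure_surfaceMeasure hF
  rw [radiusMoment, norm_neg]
  refine norm_integral_le_of_norm_le_const ?_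
  filter_upwards [ae_mem_shape hF] with x hx
  have := abs_shiftedRadius_le hF ha hr hu hx (c := 0) (by simp; positivity)
  rw [norm_smul, norm_normal hF hx, mul_one, Real.norm_eq_abs]
  simpa using this

/-- The pointwise expansion `root_sub_le`, multiplied by the unit normal and integrated. The sign in
`radiusMoment` makes the linear part `+∫ ν ⊗ ν`. -/
theorem radiusMoment_sub_le (hF : IsEllipticIntegrand F) (ha : IsConvexityConst F a)
    (hr : IsTubeConst F a r K) (hu : IsSmallRadius F r K u ε ρ) {c d : Amb n}
    (hc : ‖c‖ ≤ ρ / 8) (hd : ‖d‖ ≤ ρ / 8) :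
    ‖radiusMoment F a u ρ c - radiusMoment F a u ρ d - normalMoment F (c - d)‖ ≤
      3 * (K * (ρ + ε)) * (surfaceMeasure F).real Set.univ * ‖c - d‖ := by
  have hn := continuousOn_normal hF
  have hIc := integrable_shiftedRadius_smul hF ha hr hu hc
  have hId := integrable_shiftedRadius_smul hF ha hr hu hd
  have hIn : Integrable (fun x => ⟪normal F x, c - d⟫ • normal F x) (surfaceMeasure F) :=
    integrable_surfaceMeasure hF (ContinuousOn.smul (f := fun x => ⟪normal F x, c - d⟫)
      (hn.inner continuousOn_const) hn)
  have e : radiusMoment F a u ρ c - radiusMoment F a u ρ d - normalMoment F (c - d) =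
      -∫ x, (shiftedRadius F a u ρ c x - shiftedRadius F a u ρ d x + ⟪normal F x, c - d⟫) •
        normal F x ∂(surfaceMeasure F) := by
    simp only [add_smul, sub_smul]
    rw [integral_add (f := fun x => shiftedRadius F a u ρ c x • normal F x -
      shiftedRadius F a u ρ d x • normal F x) (hIc.sub hId) hIn, integral_sub hIc hId, normalMoment_apply hF, radiusMoment,
      radiusMoment]
    abel
  have := isFiniteMeasure_surfaceMeasure hF
  rw [e, norm_neg]
  refine (norm_integral_le_of_norm_le_const (C := 3 * (K * (ρ + ε)) * ‖c - d‖) ?_).trans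
    (le_of_eq (by ring))
  filter_upwards [ae_mem_shape hF] with x hx
  rw [norm_smul, norm_normal hF hx, mul_one, Real.norm_eq_abs]
  obtain ⟨ξ, hξ, -, rfl⟩ := exists_eq_wulffMap hF hx
  have h1 := shiftedRadius_spec hF ha hr hu hξ hc
  have h2 := shiftedRadius_spec hF ha hr hu hξ hd
  rw [normal_wulffMap hF hξ]
  exact root_sub_le hF ha hr hu hξ h1.1 h2.1 hc hd h1.2 h2.2

theorem L2Orthogonal_of_radiusMoment_eq_zero (hF : IsEllipticIntegrand F)
    (ha : IsConvexityConst F a) (hr : IsTubeConst F a r K) (hu : IsSmallRadius F r K u ε ρ)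
    {c : Amb n} (hc : ‖c‖ ≤ ρ / 8) (h0 : radiusMoment F a u ρ c = 0) (w : Amb n) :
    L2Orthogonal F (shiftedRadius F a u ρ c) (phi F w) := by
  have hcont := (smoothOnSet_shiftedRadius hF ha hr hu hc).continuousOn
  have hn := continuousOn_normal hF
  refine ⟨integrable_surfaceMeasure hF (hcont.mul (continuousOn_const.inner hn)), ?_⟩
  have hI := integrable_shiftedRadius_smul hF ha hr hu hc
  rw [radiusMoment, neg_eq_zero] at h0
  have h := integral_inner (𝕜 := ℝ) hI w
  rw [h0, inner_zero_right] at h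
  rw [← h]
  refine integral_congr_ae (Filter.Eventually.of_forall fun x => ?_)
  simp [phi, real_inner_smul_right]

/-- If `3 K (ρ + ε)` times the area is at most `κ / 2`, where `κ⁻¹` bounds the inverse of the
second moment of the normal, some translate has a radius with vanishing moments. -/
theorem exists_radiusMoment_eq_zero (hF : IsEllipticIntegrand F) (ha : IsConvexityConst F a)
    (hr : IsTubeConst F a r K) (hu : IsSmallRadius F r K u ε ρ) {e : Amb n ≃L[ℝ] Amb n}
    (he : (e : Amb n →L[ℝ] Amb n) = normalMoment F) {m R κ : ℝ}
    (hm : (surfaceMeasure F).real Set.univ ≤ m) (hκ : κ = ‖(e.symm : Amb n →L[ℝ] Amb n)‖⁻¹)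
    (hsmall : 3 * (K * (ρ + ε)) * m ≤ κ / 2) (hR : R ≤ ρ / 8) (hR0 : 0 ≤ R)
    (hRε : 4 / 3 * ε * m ≤ κ / 2 * R) :
    ∃ c : Amb n, ‖c‖ ≤ R ∧ radiusMoment F a u ρ c = 0 := by
  have h0 : 0 ≤ K * (ρ + ε) :=
    mul_nonneg hr.K_pos.le (add_nonneg hu.rho_pos.le hu.eps_nonneg)
  have hm0 : 0 ≤ m := measureReal_nonneg.trans hm
  have happ : ApproximatesLinearOn (radiusMoment F a u ρ) (e : Amb n →L[ℝ] Amb n)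
      (Metric.closedBall 0 (ρ / 8)) (Real.toNNReal (3 * (K * (ρ + ε)) * m)) := by
    intro c hc d hd
    rw [mem_closedBall_zero_iff] at hc hd
    rw [he, Real.coe_toNNReal _ (by positivity)]
    refine (radiusMoment_sub_le hF ha hr hu hc hd).trans ?_
    gcongr
  -- The image of the ball of radius `R` contains the ball of radius at least `κR/2` around the
  -- value at `0`, and that value has norm at most `κR/2`.
  have hsurj := happ.surjOn_closedBall_of_nonlinearRightInverse e.toNonlinearRightInverse
    hR0 (Metric.closedBall_subset_closedBall hR)
  have hmem : (0 : Amb n) ∈ Metric.closedBall (radiusMoment F a u ρ 0)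
      (((e.toNonlinearRightInverse.nnnorm : ℝ)⁻¹ -
        (Real.toNNReal (3 * (K * (ρ + ε)) * m) : ℝ)) * R) := by
    rw [mem_closedBall_iff_norm, zero_sub, norm_neg, Real.coe_toNNReal _ (by positivity)]
    have e1 : ((e.toNonlinearRightInverse.nnnorm : ℝ)⁻¹) = κ := by rw [hκ]; rfl
    rw [e1]
    have h1 := norm_radiusMoment_zero_le hF ha hr hu
    have h2 : 4 / 3 * ε * (surfaceMeasure F).real Set.univ ≤ 4 / 3 * ε * m := by
      have := hu.eps_nonneg
      gcongr
    have h3 : κ / 2 * R ≤ (κ - 3 * (K * (ρ + ε)) * m) * R := by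
      gcongr
      linarith
    linarith
  obtain ⟨c, hc, hc0⟩ := hsurj hmem
  exact ⟨c, mem_closedBall_zero_iff.1 hc, hc0⟩

end Wulff

end

/-! ### Choice of the constants -/

theorem mainTheorem6 (n : ℕ) (hn : 1 ≤ n) (F : Wulff.Sph n → ℝ)
    (hF : Wulff.IsEllipticIntegrand F) :
    ∃ ε₀ C₀ : ℝ, 0 < ε₀ ∧ 0 < C₀ ∧
      ∀ (S : Set (Wulff.Amb n)) (u : Wulff.Amb n → ℝ) (ε : ℝ),
        Wulff.IsRadialGraph F S u → Wulff.C1norm F u ≤ ε → ε ≤ ε₀ →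
        ∃ (c : Wulff.Amb n) (uc : Wulff.Amb n → ℝ),
          Wulff.IsRadialGraph F ((fun y => y - c) '' S) uc ∧
          Wulff.C1norm F uc ≤ C₀ * ε ∧
          ∀ w : Wulff.Amb n, Wulff.L2Orthogonal F uc (Wulff.phi F w) := by
  open Wulff in
  obtain ⟨a, ha⟩ := exists_isConvexityConst hF
  obtain ⟨r, K, hr⟩ := exists_isTubeConst hF ha
  obtain ⟨e, he⟩ := exists_normalMoment_equiv hF
  have hap := ha.pos
  have hKp := hr.K_pos
  have hrp := hr.r_pos
  -- Adding `1` makes `m` positive without a lower bound on the area.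
  set m := (surfaceMeasure F).real Set.univ + 1 with hm
  have hmp : 0 < m := by
    have := measureReal_nonneg (μ := surfaceMeasure F) (s := Set.univ)
    linarith
  set κ := ‖(e.symm : Amb n →L[ℝ] Amb n)‖⁻¹ with hκ
  have hκp : 0 < κ := inv_pos.2 e.norm_symm_pos
  -- The bound aimed at for `K(ρ + ε)`, half of it for each summand: `1/4` serves the root
  -- estimates, and `κ/(6m)` makes the perturbation of `M` at most `κ/2`.
  set η := min (1 / 4) (κ / (6 * m)) with hη
  have hηp : 0 < η := by positivity
  set ρ := min r (η / (2 * K)) with hρ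
  have hρp : 0 < ρ := by positivity
  have hρK : K * ρ ≤ η / 2 := by
    calc K * ρ ≤ K * (η / (2 * K)) := by gcongr; exact min_le_right _ _
      _ = η / 2 := by field_simp
  -- The zero is sought in the ball of radius `Bε`, where `(κ/2)Bε = 2mε` exceeds the bound
  -- `(4/3)εm` for the moment at `0`.
  set B := 4 * m / κ with hB
  have hBp : 0 < B := by positivity
  refine ⟨min (ρ / 8) (min (η / (2 * K)) (ρ / (8 * B))),
    (2 + 4 * K * (K + a) / a) * (1 + B), by positivity, by positivity, ?_⟩
  intro S u ε hS hC1 hε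
  have hε1 : ε ≤ ρ / 8 := hε.trans (min_le_left _ _)
  have hε2 : K * ε ≤ η / 2 := by
    calc K * ε ≤ K * (η / (2 * K)) := by
          gcongr
          exact hε.trans ((min_le_right _ _).trans (min_le_left _ _))
      _ = η / 2 := by field_simp
  have hε3 : B * ε ≤ ρ / 8 := by
    calc B * ε ≤ B * (ρ / (8 * B)) := by
          gcongr
          exact hε.trans ((min_le_right _ _).trans (min_le_right _ _))
      _ = ρ / 8 := by field_simp
  -- Nonnegativity of `ε` is inherited from the norm, the shape being nonempty.
  have hε0 : 0 ≤ ε := by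
    obtain ⟨x, hx⟩ := shape_nonempty hF
    exact ((abs_nonneg _).trans (abs_le_C1norm hF hS.1 hx)).trans hC1
  have hKρε : K * (ρ + ε) ≤ η := by linarith
  have hu : IsSmallRadius F r K u ε ρ :=
    { smooth := hS.1
      abs_le := fun x hx => (abs_le_C1norm hF hS.1 hx).trans hC1
      grad_le := fun x hx => (norm_tangentialGradient_le_C1norm hF hS.1 hx).trans hC1
      eps_nonneg := hε0
      rho_pos := hρp
      rho_le := min_le_left _ _
      eps_le := hε1
      mul_le := hKρε.trans (min_le_left _ _) }
  obtain ⟨c, hcR, hc0⟩ := exists_radiusMoment_eq_zero hF ha hr hu he (m := m) (R := B * ε)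
    (by linarith) hκ (by
      calc 3 * (K * (ρ + ε)) * m ≤ 3 * (κ / (6 * m)) * m := by
            gcongr
            exact hKρε.trans (min_le_right _ _)
        _ = κ / 2 := by field_simp; norm_num) hε3 (by positivity) (by
      have : κ / 2 * (B * ε) = 2 * ε * m := by rw [hB]; field_simp; ring
      rw [this]
      gcongr
      norm_num)
  have hc : ‖c‖ ≤ ρ / 8 := hcR.trans hε3
  refine ⟨c, shiftedRadius F a u ρ c, isRadialGraph_shiftedRadius hF ha hr hu hc hS, ?_,
    L2Orthogonal_of_radiusMoment_eq_zero hF ha hr hu hc hc0⟩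
  calc C1norm F (shiftedRadius F a u ρ c) ≤ (2 + 4 * K * (K + a) / a) * (ε + ‖c‖) :=
        C1norm_shiftedRadius_le hF ha hr hu hc
    _ ≤ (2 + 4 * K * (K + a) / a) * (ε + B * ε) := by gcongr
    _ = (2 + 4 * K * (K + a) / a) * (1 + B) * ε := by ring
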